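/- **Setting.** Let $\mathsf Z$ be a Borel subset of $\mathbb R^m$, let $P$ be a Feller stochastic kernel on $\mathsf Z$, and let $\{z_t\}_{t\ge 0}$ be a Markov process with kernel $P$. Let $\{\zeta_t\}_{t\ge1}$ and $\{\eta_t\}_{t\ge1}$ be i.i.d. with laws $\nu$ and $\mu$ respectively, with these two sequences and $\{z_t\}$ mutually independent. Let $R,Y\ge 0$ be real-valued measurable functions and set $R_t=R(z_t,\zeta_t)$, $Y_t=Y(z_t,\eta_t)$. Hats denote next-period variables. Write $\mathbb E_z=\mathbb E[\,\cdot\mid z_0=z]$, so that $$\mathbb E_z f(\hat z,\hat R,\hat Y)=\int f\big(\hat z,R(\hat z,\hat\zeta),Y(\hat z,\hat\eta)\big)\,P(z,d\hat z)\,\nu(d\hat\zeta)\,\mu(d\hat\eta).$$ Let $\beta\in[0,1)$, let $u:[0,\infty)\to\{-\infty\}\cup\mathbb R$, and let $u'(0):=\infty$. Put $\mathsf S_0=(0,\infty)\times\mathsf Z$. A *feasible policy* is a Borel function $c:\mathsf S_0\to\mathbb R$ with $0\le c(a,z)\le a$. It generates assets $a_{t+1}=R_{t+1}(a_t-c(a_t,z_t))+Y_{t+1}$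 from $(a_0,z_0)=(a,z)\in\mathsf S_0$ (with $c(0,z):=0$) and has lifetime value $V_c(a,z)=\mathbb E_{a,z}\sum_{t\ge0}\beta^t u(c(a_t,z_t))$. A feasible policy $c^*$ is *optimal* if $V_c\le V_{c^*}$ on $\mathsf S_0$ for every feasible policy $c$. Let $\mathscr C$ be the set of continuous functions $c:\mathsf S_0\to\mathbb R$ that are increasing (in the weak sense) in the first argument and satisfy $0<c(a,z)\le a$ and $\sup_{(a,z)\in\mathsf S_0}|u'(c(a,z))-u'(a)|<\infty$. Let $$\rho(c,d)=\sup_{(a,z)\in\mathsf S_0}|u'(c(a,z))-u'(d(a,z))| .$$ The *Coleman operator* $T$ maps $c\in\mathscr C$ to the function whose value at $(a,z)\in \mathsf S_0$ is the $\xi\in(0,a]$ that solves $$u'(\xi)=\max\Big\{\beta\,\mathbb E_z \hat R\,(u'\circ c)\big(\hat R(a-\xi)+\hat Y,\hat z\big),\;u'(a)\Big\}.$$ **Assumptions.** 1. $u$ is real-valued and twice differentiable on $(0,\infty)$ with $u'>0$, $u''<0$ there, $u'(c)\to\infty$ as $c\to0$, $u'(c)\to0$ as $c\to\infty$; and $u(0)\le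 u(c)$ for all $c>0$. 2. $n\ge1$ is an integer such that $\theta:=\beta^n\sup_{z\in\mathsf Z}\mathbb E_z R_1\cdots R_n<1$. 3. $\sum_{t\ge1}\beta^t\,\mathbb E_zY_t<\infty$ for all $z\in\mathsf Z$. 4. $\sup_z\mathbb E_z\hat R<\infty$, $\sup_z\mathbb E_zu'(\hat Y)<\infty$ and $\sup_z\mathbb E_z\hat R\,u'(\hat Y)<\infty$. 5. The functions $z\mapsto R(z,\zeta)$ and $z\mapsto Y(z,\eta)$ (for all $\zeta$, $\eta$), $z\mapsto\mathbb E_z\hat R$ and $z\mapsto\mathbb E_z\hat R\,u'(\hat Y)$ are continuous. **Theorem.** Under Assumptions 1–5, $(\mathscr C,\rho)$ is a complete metric space, the Coleman operator $T$ is a well-defined map from $\mathscr C$ to $\mathscr C$ (for each $c\in\mathscr C$ and $(a,z)\in\mathsf S_0$ the solution $\xi$ exists and is unique, and $Tc\in\mathscr C$), and $T^n$ is a contraction on $(\mathscr C,\rho)$ with modulus $\theta$: $\rho(T^nc,T^nd)\le\theta\,\rho(c,d)$ for all $c,d\in\mathscr C$. Moreover: 1. $T$ has a unique fixed point $c^*\in\mathscr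 C$. 2. $c^*$ is an optimal policy, and it is the only optimal policy in $\mathscr C$. 3. $\rho(T^{nk}c,c^*)\le\theta^k\rho(c,c^*)$ for all $c\in\mathscr C$ and all integers $k\ge0$. -/

import Mathlib

open MeasureTheory ProbabilityTheory Filter Topology Set
open scoped ENNReal NNReal BoundedContinuousFunction

noncomputable section

/-- The data of an income fluctuation problem with capital income risk: the exogenous state lives in
`Z`, the return innovations in `E` and the income innovations in `H`. -/
structure IncomeFluctuation (Z E H : Type*) [TopologicalSpace Z] [MeasurableSpace Z]
    [MeasurableSpace E] [MeasurableSpace H] where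
  /-- discount factor -/
  β : ℝ≥0
  β_lt_one : β < 1
  /-- utility function on `[0, ∞)`, with values in `{-∞} ∪ ℝ` -/
  u : ℝ≥0 → EReal
  u_ne_top : ∀ x, u x ≠ ⊤
  /-- gross return on wealth -/
  R : Z × E → ℝ≥0
  measurable_R : Measurable R
  /-- labor income -/
  Y : Z × H → ℝ≥0
  measurable_Y : Measurable Y
  /-- transition kernel of the exogenous state -/
  P : Kernel Z Z
  isMarkovKernel_P : IsMarkovKernel P
  feller : ∀ f : Z →ᵇ ℝ, Continuous fun z => ∫ y, f y ∂(P z)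
  /-- law of the return innovations -/
  ν : Measure E
  isProbabilityMeasure_ν : IsProbabilityMeasure ν
  /-- law of the income innovations -/
  μ : Measure H
  isProbabilityMeasure_μ : IsProbabilityMeasure μ

namespace IncomeFluctuation

variable {Z E H : Type*} [TopologicalSpace Z] [MeasurableSpace Z] [MeasurableSpace E]
  [MeasurableSpace H] (M : IncomeFluctuation Z E H)

attribute [instance] isMarkovKernel_P isProbabilityMeasure_ν isProbabilityMeasure_μ

/-- The state space `(0, ∞) × Z` of pairs (assets, exogenous state). -/
abbrev State (Z : Type*) : Type _ := Set.Ioi (0 : ℝ) × Z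

/-! ### Utility -/

/-- The utility function as a real function; only its values on `(0, ∞)` are used. -/
def realUtility (x : ℝ) : ℝ := (M.u x.toNNReal).toReal

/-- Marginal utility `u'`; only its values on `(0, ∞)` are used. -/
def marginal (x : ℝ) : ℝ := deriv M.realUtility x

/-- Marginal utility on `[0, ∞)` with the convention `u'(0) = ∞`. -/
def marginalE (x : ℝ) : ℝ≥0∞ := if 0 < x then ENNReal.ofReal (M.marginal x) else ⊤

/-- The assumption on utility. The clause `zero_le` says that `u` does not jump down
to the right of `0`, so that it is increasing and concave on all of `[0, ∞)`. -/
structure UtilityAssumption : Prop where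
  finite : ∀ x, 0 < x → M.u x ≠ ⊥
  zero_le : ∀ x, M.u 0 ≤ M.u x
  differentiable : ∀ x : ℝ, 0 < x → DifferentiableAt ℝ M.realUtility x
  differentiable_marginal : ∀ x : ℝ, 0 < x → DifferentiableAt ℝ M.marginal x
  marginal_pos : ∀ x : ℝ, 0 < x → 0 < M.marginal x
  deriv_marginal_neg : ∀ x : ℝ, 0 < x → deriv M.marginal x < 0
  marginal_zero : Tendsto M.marginal (𝓝[>] 0) atTop
  marginal_infty : Tendsto M.marginal atTop (𝓝 0)

/-! ### The exogenous process -/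

/-- The law `P(z, ·) ⊗ ν ⊗ μ` of next period's `(ẑ, ζ̂, η̂)` when the current exogenous state
is `z`. -/
def shockKernel : Kernel Z (Z × E × H) := M.P ×ₖ Kernel.const Z (M.ν.prod M.μ)

/-- The conditional law of `(z_{t+1}, ζ_{t+1}, η_{t+1})` given `(z_i, ζ_i, η_i)` for `i ≤ t`. -/
def historyKernel (t : ℕ) : Kernel (Finset.Iic t → Z × E × H) (Z × E × H) :=
  M.shockKernel.comap (fun h => (h ⟨t, Finset.mem_Iic.2 le_rfl⟩).1) (by fun_prop)

instance (t : ℕ) : IsMarkovKernel (M.historyKernel t) := by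
  unfold historyKernel shockKernel
  infer_instance

/-- The law of `(z_t, ζ_t, η_t)_{t ≥ 0}` given `z_0 = z`: `z_t` is Markov with kernel `P`, and
`ζ_t`, `η_t` are i.i.d. with laws `ν`, `μ`, all mutually independent. The innovations at time `0`
are never used. -/
def pathLaw (z : Z) : Measure (ℕ → Z × E × H) :=
  Kernel.trajMeasure (X := fun _ => Z × E × H)
    ((Measure.dirac z).prod (M.ν.prod M.μ)) M.historyKernel

/-- `R_t` as a function of the path. -/
def returnAt (ω : ℕ → Z × E × H) (t : ℕ) : ℝ≥0 := M.R ((ω t).1, (ω t).2.1)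

/-- `Y_t` as a function of the path. -/
def incomeAt (ω : ℕ → Z × E × H) (t : ℕ) : ℝ≥0 := M.Y ((ω t).1, (ω t).2.2)

/-- `θ = βⁿ sup_z E_z R_1 ⋯ R_n`. -/
def theta (n : ℕ) : ℝ≥0∞ :=
  (M.β : ℝ≥0∞) ^ n *
    ⨆ z : Z, ∫⁻ ω, ∏ t ∈ Finset.Icc 1 n, (M.returnAt ω t : ℝ≥0∞) ∂(M.pathLaw z)

/-- `E_z R̂`. -/
def meanReturn (z : Z) : ℝ≥0∞ :=
  ∫⁻ x, (M.R (x.1, x.2.1) : ℝ≥0∞) ∂(M.shockKernel z)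

/-- `E_z u'(Ŷ)`. -/
def meanMarginalIncome (z : Z) : ℝ≥0∞ :=
  ∫⁻ x, M.marginalE (M.Y (x.1, x.2.2)) ∂(M.shockKernel z)

/-- `E_z R̂ u'(Ŷ)`. -/
def meanReturnMarginalIncome (z : Z) : ℝ≥0∞ :=
  ∫⁻ x, (M.R (x.1, x.2.1) : ℝ≥0∞) * M.marginalE (M.Y (x.1, x.2.2)) ∂(M.shockKernel z)

/-- Discounted expected income is finite: `∑_{t ≥ 1} βᵗ E_z Y_t < ∞` for all `z`. -/
def IncomeAssumption : Prop :=
  ∀ z : Z, (∑' t : ℕ,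
    (M.β : ℝ≥0∞) ^ (t + 1) * ∫⁻ ω, (M.incomeAt ω (t + 1) : ℝ≥0∞) ∂(M.pathLaw z)) < ⊤

/-- The uniform moment bounds. -/
structure MomentAssumption : Prop where
  mean_return : (⨆ z, M.meanReturn z) < ⊤
  mean_marginal : (⨆ z, M.meanMarginalIncome z) < ⊤
  mean_return_marginal : (⨆ z, M.meanReturnMarginalIncome z) < ⊤

/-- The continuity conditions. -/
structure ContinuityAssumption : Prop where
  continuous_R : ∀ ζ : E, Continuous fun z => M.R (z, ζ)
  continuous_Y : ∀ η : H, Continuous fun z => M.Y (z, η)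
  continuous_meanReturn : Continuous M.meanReturn
  continuous_meanReturnMarginal : Continuous M.meanReturnMarginalIncome

/-! ### Policies, lifetime value, optimality -/

/-- A policy on `(0, ∞) × Z`, extended by `0` to zero assets. -/
def extend (c : State Z → ℝ) (a : ℝ) (z : Z) : ℝ :=
  if h : 0 < a then c (⟨a, h⟩, z) else 0

/-- A feasible policy: Borel measurable with `0 ≤ c(a, z) ≤ a`. -/
def IsFeasible (c : State Z → ℝ) : Prop :=
  Measurable c ∧ ∀ s, 0 ≤ c s ∧ c s ≤ s.1

/-- The asset path `a_{t+1} = R_{t+1} (a_t - c(a_t, z_t)) + Y_{t+1}`, `a_0 = a`. -/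
def assetPath (c : State Z → ℝ) (a : ℝ) (ω : ℕ → Z × E × H) : ℕ → ℝ
  | 0 => a
  | t + 1 =>
    M.returnAt ω (t + 1) *
        (assetPath c a ω t - extend c (assetPath c a ω t) (ω t).1) +
      M.incomeAt ω (t + 1)

/-- Period utility `u(c(a_t, z_t))` along the asset path. -/
def periodUtility (c : State Z → ℝ) (a : ℝ) (ω : ℕ → Z × E × H) (t : ℕ) : EReal :=
  M.u (extend c (M.assetPath c a ω t) (ω t).1).toNNReal

/-- Lifetime value `V_c(a, z) = E_{a,z} ∑_t βᵗ u(c(a_t, z_t))` in `[-∞, ∞)`, as the expected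
discounted sum of the positive parts minus that of the negative parts. -/
def lifetimeValue (c : State Z → ℝ) (s : State Z) : EReal :=
  ((∫⁻ ω, ∑' t, (M.β : ℝ≥0∞) ^ t * (M.periodUtility c s.1 ω t).toENNReal
      ∂(M.pathLaw s.2) : ℝ≥0∞) : EReal) -
  ((∫⁻ ω, ∑' t, (M.β : ℝ≥0∞) ^ t * (-M.periodUtility c s.1 ω t).toENNReal
      ∂(M.pathLaw s.2) : ℝ≥0∞) : EReal)

/-- An optimal policy: feasible, with the largest lifetime value among all feasible policies, at
every initial condition. -/
def IsOptimal (c : State Z → ℝ) : Prop :=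
  IsFeasible c ∧ ∀ d : State Z → ℝ, IsFeasible d →
    ∀ s, M.lifetimeValue d s ≤ M.lifetimeValue c s

/-! ### Candidate policies and the Coleman operator -/

/-- The space `𝒞` of candidate policies. -/
structure Candidate where
  toFun : State Z → ℝ
  continuous : Continuous toFun
  monotone : ∀ z : Z, Monotone fun a : Set.Ioi (0 : ℝ) => toFun (a, z)
  pos : ∀ s, 0 < toFun s
  le_assets : ∀ s, toFun s ≤ s.1
  bounded : ∃ K : ℝ, ∀ s, |M.marginal (toFun s) - M.marginal s.1| ≤ K

variable {M} in
/-- The distance `ρ(c, d) = sup |u' ∘ c - u' ∘ d|`. -/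
def rho (c d : M.Candidate) : ℝ≥0∞ :=
  ⨆ s : State Z, ENNReal.ofReal |M.marginal (c.toFun s) - M.marginal (d.toFun s)|

/-- `ψ_c(ξ, a, z) = max {β E_z R̂ (u' ∘ c)(R̂ (a - ξ) + Ŷ, ẑ), u'(a)}`. -/
def psi (c : State Z → ℝ) (ξ a : ℝ) (z : Z) : ℝ≥0∞ :=
  max
    ((M.β : ℝ≥0∞) * ∫⁻ x, (M.R (x.1, x.2.1) : ℝ≥0∞) *
      M.marginalE (extend c (M.R (x.1, x.2.1) * (a - ξ) + M.Y (x.1, x.2.2)) x.1)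
        ∂(M.shockKernel z))
    (M.marginalE a)

/-- `T` is the Coleman operator: `Tc(a, z)` is the one and only `ξ ∈ (0, a]` that solves
`u'(ξ) = ψ_c(ξ, a, z)`. -/
def IsColeman (T : M.Candidate → M.Candidate) : Prop :=
  ∀ (c : M.Candidate) (s : State Z) (ξ : ℝ),
    (ξ ∈ Set.Ioc (0 : ℝ) s.1 ∧ M.marginalE ξ = M.psi c.toFun ξ s.1 s.2) ↔ ξ = (T c).toFun s

end IncomeFluctuation

end

/-!
The map `c ↦ u' ∘ c - u'` identifies `𝒞`, with the metric `ρ`, with a closed set of bounded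
continuous functions, so `𝒞` is complete. If `u' ∘ c ≤ u' ∘ d + γ(z)` then
`u' ∘ Tc ≤ u' ∘ Td + β E_z R̂ γ(ẑ)`, because a smaller `ξ` means larger savings, which only lower
the right-hand side of the Euler equation. Iterating `n` times from a constant `γ` produces the
factor `βⁿ E_z R_1 ⋯ R_n ≤ θ`, although no single application of `T` need contract.

That `Tc` is continuous rests on the continuity of `E_z R̂ (u' ∘ c)(R̂ x + Ŷ, ẑ)`, whose integrand
is unbounded. By the Feller property, integrals of nonnegative continuous functions are lower
semicontinuous; the integrand and its gap to the dominating function `R̂ (u'(Ŷ) + K)`, whose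
integral is continuous by assumption, are both of this kind.

A fixed point `c` solves the Euler equation along its path `(c_t)`, with equality whenever
something is saved. Hence at the state prices `βᵗ u'(c_t)` no feasible consumption path is worth
more than `(c_t)`, and the tangent inequality `u(d_t) ≤ u(c_t) + u'(c_t) (d_t - c_t)`, which is
strict for `d_t ≠ c_t`, turns this into optimality and uniqueness. The infinite sums that are
cancelled are finite because `∑ₖ βᵏ E_z R_1 ⋯ R_k` is bounded in `z`.
-/

noncomputable section

/-! ### Semicontinuity -/

/-- The largest function below `min F k` that is `k`-Lipschitz. These functions increase with `k`
to the lower semicontinuous envelope of `F`. -/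
def lipschitzReg {X : Type*} [PseudoEMetricSpace X] (F : X → ℝ≥0∞) (k : ℕ) (p : X) : ℝ≥0∞ :=
  ⨅ q, (min (F q) k + k * edist p q)

section LipschitzReg

variable {X : Type*} [PseudoEMetricSpace X] (F : X → ℝ≥0∞)

lemma lipschitzReg_le_min (k : ℕ) (p : X) : lipschitzReg F k p ≤ min (F p) k :=
  (iInf_le _ p).trans (by rw [edist_self, mul_zero, add_zero])

lemma lipschitzReg_le_natCast (k : ℕ) (p : X) : lipschitzReg F k p ≤ k :=
  (lipschitzReg_le_min F k p).trans (min_le_right _ _)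

lemma lipschitzReg_ne_top (k : ℕ) (p : X) : lipschitzReg F k p ≠ ⊤ :=
  ne_top_of_le_ne_top (ENNReal.natCast_ne_top k) (lipschitzReg_le_natCast F k p)

lemma monotone_lipschitzReg (p : X) : Monotone fun k => lipschitzReg F k p := fun j k h =>
  iInf_mono fun q => by gcongr

lemma lipschitzReg_le_add_mul_edist (k : ℕ) (p p' : X) :
    lipschitzReg F k p ≤ lipschitzReg F k p' + k * edist p p' := by
  unfold lipschitzReg
  rw [ENNReal.iInf_add]
  refine iInf_mono fun q => ?_
  rw [add_assoc, ← mul_add, add_comm (edist p' q)]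
  gcongr
  exact edist_triangle _ _ _

lemma lipschitzWith_toReal_lipschitzReg {X : Type*} [PseudoMetricSpace X] (F : X → ℝ≥0∞) (k : ℕ) :
    LipschitzWith k fun p => (lipschitzReg F k p).toReal := by
  refine LipschitzWith.of_le_add_mul _ fun p p' => ?_
  have h_fin : (k : ℝ≥0∞) * edist p p' ≠ ⊤ :=
    ENNReal.mul_ne_top (ENNReal.natCast_ne_top k) (edist_ne_top _ _)
  refine (ENNReal.toReal_le_add (lipschitzReg_le_add_mul_edist F k p p')
    (lipschitzReg_ne_top F k p') h_fin).trans_eq ?_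
  rw [ENNReal.toReal_mul, ENNReal.toReal_natCast, edist_dist, ENNReal.toReal_ofReal dist_nonneg,
    NNReal.coe_natCast]

lemma iSup_lipschitzReg {F : X → ℝ≥0∞} (hF : LowerSemicontinuous F) (p : X) :
    ⨆ k, lipschitzReg F k p = F p := by
  refine le_antisymm (iSup_le fun k => (lipschitzReg_le_min F k p).trans (min_le_left _ _))
    (le_of_forall_lt fun y hy => ?_)
  obtain ⟨y', hyy', hy'⟩ := exists_between hy
  obtain ⟨δ, hδ, hball⟩ := EMetric.mem_nhds_iff.1 (hF p y' hy')
  have hy'_top : y' ≠ ⊤ := hy'.ne_top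
  obtain ⟨k, hk⟩ := ENNReal.exists_nat_gt (r := y' + y' / δ)
    (ENNReal.add_ne_top.2 ⟨hy'_top, (ENNReal.div_lt_top hy'_top hδ.ne').ne⟩)
  refine hyy'.trans_le (le_iSup_of_le k (le_iInf fun q => ?_))
  by_cases hq : q ∈ Metric.eball p δ
  · exact le_add_right (le_min (hball hq).le (le_self_add.trans hk.le))
  · have hδ_le : δ ≤ edist p q := by
      rw [edist_comm]
      exact not_lt.1 hq
    refine le_add_left (le_trans ?_ (mul_le_mul_right hδ_le k))
    exact (ENNReal.div_le_iff_le_mul (.inl hδ.ne') (.inr (pos_of_gt hk).ne')).1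
      (le_add_self.trans hk.le)

end LipschitzReg

section Feller

variable {X Z : Type*} [TopologicalSpace Z] [MeasurableSpace Z] [OpensMeasurableSpace Z]
  (P : Kernel Z Z) [IsMarkovKernel P]

lemma continuous_integral_of_feller [PseudoMetricSpace X]
    (feller : ∀ f : Z →ᵇ ℝ, Continuous fun z => ∫ y, f y ∂(P z)) {K : ℝ≥0} {C : ℝ} {g : X × Z → ℝ}
    (hg_cont : ∀ x, Continuous fun y => g (x, y)) (hg_lip : ∀ y, LipschitzWith K fun x => g (x, y))
    (hg_bdd : ∀ p, ‖g p‖ ≤ C) :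
    Continuous fun p : X × Z => ∫ y, g (p.1, y) ∂(P p.2) := by
  have h_int : ∀ x z, Integrable (fun y => g (x, y)) (P z) := fun x z =>
    (integrable_const C).mono' (hg_cont x).measurable.aestronglyMeasurable
      (ae_of_all _ fun y => hg_bdd (x, y))
  refine continuous_prod_of_continuous_lipschitzWith _ K
    (fun x => feller (.ofNormedAddCommGroup _ (hg_cont x) C fun y => hg_bdd (x, y))) fun z => ?_
  refine LipschitzWith.of_dist_le_mul fun x x' => ?_
  rw [dist_eq_norm, ← integral_sub (h_int x z) (h_int x' z)]
  refine (norm_integral_le_of_norm_le_const (ae_of_all _ fun y => ?_)).trans_eq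
    (by rw [probReal_univ, mul_one])
  rw [← dist_eq_norm]
  exact (hg_lip y).dist_le_mul x x'

/-- A Feller kernel is weakly continuous, so the integral of a jointly lower semicontinuous
integrand is jointly lower semicontinuous. -/
theorem lowerSemicontinuous_lintegral_of_feller [TopologicalSpace X]
    [TopologicalSpace.PseudoMetrizableSpace X] [TopologicalSpace.PseudoMetrizableSpace Z]
    (feller : ∀ f : Z →ᵇ ℝ, Continuous fun z => ∫ y, f y ∂(P z)) {F : X × Z → ℝ≥0∞}
    (hF : LowerSemicontinuous F) :
    LowerSemicontinuous fun p : X × Z => ∫⁻ y, F (p.1, y) ∂(P p.2) := by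
  let _ := TopologicalSpace.pseudoMetrizableSpacePseudoMetric X
  let _ := TopologicalSpace.pseudoMetrizableSpacePseudoMetric Z
  let g : ℕ → X × Z → ℝ := fun k p => (lipschitzReg F k p).toReal
  have hg_lip : ∀ k : ℕ, LipschitzWith k (g k) := lipschitzWith_toReal_lipschitzReg F
  have hg_cont : ∀ k x, Continuous fun y => g k (x, y) := fun k x =>
    (hg_lip k).continuous.comp (by fun_prop)
  have hg_bdd : ∀ k p, ‖g k p‖ ≤ k := fun k p => by
    rw [Real.norm_of_nonneg ENNReal.toReal_nonneg]
    exact ENNReal.toReal_le_of_le_ofReal k.cast_nonneg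
      ((lipschitzReg_le_natCast F k p).trans_eq (ENNReal.ofReal_natCast k).symm)
  have h_ofReal : ∀ k p, ENNReal.ofReal (g k p) = lipschitzReg F k p := fun k p =>
    ENNReal.ofReal_toReal (lipschitzReg_ne_top F k p)
  have h_iSup : ∀ p : X × Z,
      ∫⁻ y, F (p.1, y) ∂(P p.2) = ⨆ k, ENNReal.ofReal (∫ y, g k (p.1, y) ∂(P p.2)) := fun p => by
    have h_mono : Monotone fun k y => ENNReal.ofReal (g k (p.1, y)) := fun j k h y => by
      simpa only [h_ofReal] using monotone_lipschitzReg F (p.1, y) h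
    calc ∫⁻ y, F (p.1, y) ∂(P p.2) = ∫⁻ y, ⨆ k, ENNReal.ofReal (g k (p.1, y)) ∂(P p.2) := by
          simp only [h_ofReal, iSup_lipschitzReg hF]
      _ = ⨆ k, ∫⁻ y, ENNReal.ofReal (g k (p.1, y)) ∂(P p.2) :=
          lintegral_iSup (fun k => (hg_cont k p.1).measurable.ennreal_ofReal) h_mono
      _ = ⨆ k, ENNReal.ofReal (∫ y, g k (p.1, y) ∂(P p.2)) := by
          refine iSup_congr fun k => (ofReal_integral_eq_lintegral_ofReal ?_ ?_).symm
          · exact (integrable_const (k : ℝ)).mono' (hg_cont k p.1).measurable.aestronglyMeasurable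
              (ae_of_all _ fun y => hg_bdd k (p.1, y))
          · exact ae_of_all _ fun _ => ENNReal.toReal_nonneg
  simp only [h_iSup]
  refine lowerSemicontinuous_iSup fun k => Continuous.lowerSemicontinuous ?_
  refine ENNReal.continuous_ofReal.comp
    (continuous_integral_of_feller P feller (K := k) (hg_cont k) (fun y => ?_) (hg_bdd k))
  simpa only [mul_one, Function.comp_def] using (hg_lip k).comp (LipschitzWith.prodMk_right y)

end Feller

theorem lowerSemicontinuous_lintegral {X Ω : Type*} [TopologicalSpace X]
    [FirstCountableTopology X] [MeasurableSpace Ω] (μ : Measure Ω) {f : X → Ω → ℝ≥0∞}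
    (hm : ∀ x, Measurable (f x)) (hf : ∀ ω, LowerSemicontinuous fun x => f x ω) :
    LowerSemicontinuous fun x => ∫⁻ ω, f x ω ∂μ := fun x =>
  lowerSemicontinuousAt_iff_le_liminf.2 <|
    (lintegral_mono fun ω => LowerSemicontinuousAt.le_liminf (hf ω x)).trans
      (lintegral_liminf_le hm)

lemma lowerSemicontinuous_of_eq_zero_or_continuousAt {X : Type*} [TopologicalSpace X]
    {f : X → ℝ≥0∞} (h : ∀ x, f x = 0 ∨ ContinuousAt f x) : LowerSemicontinuous f := fun x => by
  rcases h x with h₀ | h_cont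
  · intro y hy
    exact absurd hy (h₀ ▸ not_lt_zero)
  · exact h_cont.lowerSemicontinuousAt

lemma continuous_of_lowerSemicontinuous_of_add_eq {X : Type*} [TopologicalSpace X]
    {f g h : X → ℝ≥0∞} (hf : LowerSemicontinuous f) (hg : LowerSemicontinuous g)
    (hh : Continuous h) (hh_top : ∀ x, h x ≠ ⊤) (hfg : ∀ x, f x + g x = h x) : Continuous f := by
  refine continuous_iff_lower_upperSemicontinuous.2 ⟨hf, fun x y hy => ?_⟩
  have hgx : g x ≠ ⊤ := ne_top_of_le_ne_top (hh_top x) (hfg x ▸ le_add_self)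
  obtain ⟨q, hhq, hqg⟩ := exists_between (hfg x ▸ ENNReal.add_lt_add_right hgx hy)
  have h_add : LowerSemicontinuous fun x' => y + g x' := lowerSemicontinuous_const.add hg
  filter_upwards [hh.continuousAt.eventually (gt_mem_nhds hhq), h_add x q hqg] with x' hhq' hqg'
  exact lt_of_add_lt_add_right ((hfg x').trans_lt (hhq'.trans hqg'))

/-! ### Calculus and summation -/

lemma continuousOn_of_strictMonoOn_of_ordConnected_image {f : ℝ → ℝ} {s : Set ℝ}
    (hf : StrictMonoOn f s) (hs : s.OrdConnected) (hfs : (f '' s).OrdConnected) :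
    ContinuousOn f s := by
  rw [continuousOn_iff_continuous_domRestrict]
  exact continuous_subtype_val.comp (hf.orderIso f s).continuous

lemma lt_add_deriv_mul_of_strictConcaveOn {f : ℝ → ℝ} {s : Set ℝ} (hf : StrictConcaveOn ℝ s f)
    {x y : ℝ} (hx : x ∈ s) (hy : y ∈ s) (hxy : x ≠ y) (hfx : DifferentiableAt ℝ f x) :
    f y < f x + deriv f x * (y - x) := by
  rcases lt_or_gt_of_ne hxy with h | h
  · have h_slope := hf.slope_lt_deriv hx hy h hfx
    rw [slope_def_field, div_lt_iff₀ (sub_pos.2 h)] at h_slope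
    linarith
  · have h_slope := hf.deriv_lt_slope hy hx h hfx
    rw [slope_def_field, lt_div_iff₀ (sub_pos.2 h)] at h_slope
    linarith

/-- An inequality between differences of real numbers, restated without subtraction through
positive and negative parts. -/
lemma ofReal_add_ofReal_neg_add_le {p q m x y δ : ℝ} (hm : 0 ≤ m) (hx : 0 ≤ x) (hy : 0 ≤ y)
    (hδ : 0 ≤ δ) (h : q + δ ≤ p + m * (y - x)) :
    ENNReal.ofReal q + ENNReal.ofReal (-p) + ENNReal.ofReal m * ENNReal.ofReal x +
        ENNReal.ofReal δ ≤
      ENNReal.ofReal p + ENNReal.ofReal (-q) + ENNReal.ofReal m * ENNReal.ofReal y := by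
  rw [← ENNReal.ofReal_mul hm, ← ENNReal.ofReal_mul hm]
  simp only [ENNReal.ofReal, ← ENNReal.coe_add, ENNReal.coe_le_coe, ← NNReal.coe_le_coe,
    NNReal.coe_add, Real.coe_toNNReal', max_eq_left (mul_nonneg hm hx),
    max_eq_left (mul_nonneg hm hy), max_eq_left hδ]
  linarith [max_zero_sub_max_neg_zero_eq_self p, max_zero_sub_max_neg_zero_eq_self q]

lemma tsum_ne_top_of_add_le_mul {w : ℕ → ℝ≥0∞} (hw : ∀ k, w k ≠ ⊤) {θ : ℝ≥0∞} (hθ : θ < 1)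
    {n : ℕ} (h : ∀ k, w (n + k) ≤ θ * w k) : ∑' k, w k ≠ ⊤ := by
  set C := ∑ k ∈ Finset.range n, w k
  have h_fin : ∀ N, ∑ k ∈ Finset.range N, w k ≠ ⊤ := fun N =>
    ENNReal.sum_ne_top.2 fun k _ => hw k
  have hθ' : 1 - θ ≠ 0 := (tsub_pos_of_lt hθ).ne'
  have h_bound : ∀ N, ∑ k ∈ Finset.range N, w k ≤ C / (1 - θ) := fun N => by
    set S := ∑ k ∈ Finset.range N, w k
    have h_shift : S ≤ C + S * θ := by
      calc S ≤ ∑ k ∈ Finset.range (n + N), w k :=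
            Finset.sum_le_sum_of_subset (Finset.range_subset_range.2 (Nat.le_add_left N n))
        _ = C + ∑ k ∈ Finset.range N, w (n + k) := Finset.sum_range_add _ _ _
        _ ≤ C + ∑ k ∈ Finset.range N, θ * w k := by
            gcongr
            exact h _
        _ = C + S * θ := by rw [← Finset.mul_sum, mul_comm]
    rwa [ENNReal.le_div_iff_mul_le (.inl hθ') (.inl (ENNReal.sub_ne_top ENNReal.one_ne_top)),
      ENNReal.mul_sub fun _ _ => h_fin N, mul_one, tsub_le_iff_right]
  exact ne_top_of_le_ne_top (ENNReal.div_lt_top (h_fin n) hθ').ne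
    (ENNReal.tsum_le_of_sum_range_le h_bound)

lemma sum_range_add_le_of_add_le_add {A B y : ℕ → ℝ≥0∞} (h : ∀ t, A t + B (t + 1) ≤ B t + y t)
    (N : ℕ) :
    ∑ t ∈ Finset.range N, A t + B N ≤ B 0 + ∑ t ∈ Finset.range N, y t := by
  induction N with
  | zero => simp only [Finset.range_zero, Finset.sum_empty, zero_add, add_zero, le_refl]
  | succ N ih =>
    calc ∑ t ∈ Finset.range (N + 1), A t + B (N + 1)
        = ∑ t ∈ Finset.range N, A t + (A N + B (N + 1)) := by
          rw [Finset.sum_range_succ, add_assoc]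
      _ ≤ ∑ t ∈ Finset.range N, A t + (B N + y N) := add_le_add_right (h N) _
      _ = ∑ t ∈ Finset.range N, A t + B N + y N := (add_assoc _ _ _).symm
      _ ≤ B 0 + ∑ t ∈ Finset.range N, y t + y N := by gcongr
      _ = B 0 + ∑ t ∈ Finset.range (N + 1), y t := by rw [Finset.sum_range_succ, add_assoc]

lemma tsum_le_add_tsum_of_add_le_add {A B y : ℕ → ℝ≥0∞}
    (h : ∀ t, A t + B (t + 1) ≤ B t + y t) : ∑' t, A t ≤ B 0 + ∑' t, y t :=
  ENNReal.tsum_le_of_sum_range_le fun N =>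
    le_self_add.trans <| (sum_range_add_le_of_add_le_add h N).trans <| by
      gcongr
      exact ENNReal.sum_le_tsum _

lemma tsum_eq_add_tsum_of_add_eq_add {A B y : ℕ → ℝ≥0∞} (h : ∀ t, A t + B (t + 1) = B t + y t)
    (hB : ∑' t, B t ≠ ⊤) : ∑' t, A t = B 0 + ∑' t, y t := by
  have h_split : ∑' t, B t = B 0 + ∑' t, B (t + 1) := tsum_eq_zero_add' ENNReal.summable
  have hB_succ : ∑' t, B (t + 1) ≠ ⊤ := ne_top_of_le_ne_top hB (h_split ▸ le_add_self)
  have h_sum : ∑' t, (A t + B (t + 1)) = ∑' t, (B t + y t) := tsum_congr h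
  rw [ENNReal.tsum_add, ENNReal.tsum_add, h_split, add_right_comm] at h_sum
  exact (ENNReal.add_left_inj hB_succ).1 h_sum

lemma tsum_add_le_tsum {f g : ℕ → ℝ≥0∞} {δ : ℝ≥0∞} (h_zero : f 0 + δ ≤ g 0)
    (h : ∀ t, f t ≤ g t) : ∑' t, f t + δ ≤ ∑' t, g t := by
  rw [tsum_eq_zero_add' ENNReal.summable, tsum_eq_zero_add' (f := g) ENNReal.summable,
    add_right_comm]
  exact add_le_add h_zero (ENNReal.tsum_le_tsum fun t => h (t + 1))

lemma coe_ennreal_sub_le_sub {A B C D : ℝ≥0∞} (hA : A ≠ ⊤) (hC : C ≠ ⊤) (h : A + D ≤ C + B) :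
    (A : EReal) - B ≤ C - D := by
  rcases eq_or_ne B ⊤ with rfl | hB
  · rw [EReal.coe_ennreal_top, EReal.sub_top]
    exact bot_le
  have hD : D ≠ ⊤ := ne_top_of_le_ne_top (ENNReal.add_ne_top.2 ⟨hC, hB⟩) (le_add_self.trans h)
  lift A to ℝ≥0 using hA
  lift B to ℝ≥0 using hB
  lift C to ℝ≥0 using hC
  lift D to ℝ≥0 using hD
  simp only [EReal.coe_nnreal_eq_coe_real, ← EReal.coe_sub, EReal.coe_le_coe_iff]
  rw [sub_le_sub_iff]
  exact_mod_cast h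

lemma coe_ennreal_sub_lt_sub {A B C D : ℝ≥0∞} (hB : B ≠ ⊤) (hC : C ≠ ⊤) (h : A + D < C + B) :
    (A : EReal) - B < C - D := by
  obtain ⟨hA, hD⟩ := ENNReal.add_ne_top.1 h.ne_top
  lift A to ℝ≥0 using hA
  lift B to ℝ≥0 using hB
  lift C to ℝ≥0 using hC
  lift D to ℝ≥0 using hD
  simp only [EReal.coe_nnreal_eq_coe_real, ← EReal.coe_sub, EReal.coe_lt_coe_iff]
  rw [sub_lt_sub_iff]
  exact_mod_cast h

namespace IncomeFluctuation

variable {Z E H : Type*} [TopologicalSpace Z] [MeasurableSpace Z] [MeasurableSpace E]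
  [MeasurableSpace H] {M : IncomeFluctuation Z E H}

/-! ### Marginal utility -/

/-- A strictly concave, differentiable utility function with `u' > 0` and `u'(0+) = ∞`. Neither a
second derivative nor `u'(∞) = 0` is assumed. As in `UtilityAssumption`, `zero_le` makes `u`
increasing and concave up to the boundary point `0`. -/
structure InadaUtility (M : IncomeFluctuation Z E H) : Prop where
  finite : ∀ x, 0 < x → M.u x ≠ ⊥
  zero_le : ∀ x, M.u 0 ≤ M.u x
  differentiable : ∀ x : ℝ, 0 < x → DifferentiableAt ℝ M.realUtility x
  marginal_pos : ∀ x : ℝ, 0 < x → 0 < M.marginal x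
  strictAntiOn_marginal : StrictAntiOn M.marginal (Ioi 0)
  marginal_zero : Tendsto M.marginal (𝓝[>] 0) atTop

lemma UtilityAssumption.inadaUtility (hu : M.UtilityAssumption) : M.InadaUtility where
  finite := hu.finite
  zero_le := hu.zero_le
  differentiable := hu.differentiable
  marginal_pos := hu.marginal_pos
  strictAntiOn_marginal := strictAntiOn_of_deriv_neg (convex_Ioi 0)
    (fun x hx => (hu.differentiable_marginal x hx).continuousAt.continuousWithinAt)
    fun x hx => hu.deriv_marginal_neg x (interior_subset hx)
  marginal_zero := hu.marginal_zero

lemma marginalE_of_pos {x : ℝ} (hx : 0 < x) : M.marginalE x = ENNReal.ofReal (M.marginal x) :=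
  if_pos hx

lemma marginalE_of_nonpos {x : ℝ} (hx : x ≤ 0) : M.marginalE x = ⊤ := if_neg hx.not_gt

lemma marginalE_ne_top {x : ℝ} (hx : 0 < x) : M.marginalE x ≠ ⊤ := by
  rw [marginalE_of_pos hx]
  exact ENNReal.ofReal_ne_top

lemma pos_of_marginalE_ne_top {x : ℝ} (hx : M.marginalE x ≠ ⊤) : 0 < x :=
  not_le.1 fun h => hx (marginalE_of_nonpos h)

namespace InadaUtility

variable (hu : M.InadaUtility)
include hu

/-- A derivative has the intermediate value property, and a monotone function with that property is
continuous. -/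
lemma continuousOn_marginal : ContinuousOn M.marginal (Ioi 0) := by
  have h_image : ((fun x => -M.marginal x) '' Ioi 0).OrdConnected := by
    simpa only [deriv.fun_neg] using!
      ordConnected_Ioi.image_deriv (f := fun x => -M.realUtility x)
        fun x hx => (hu.differentiable x hx).fun_neg
  have h_neg : StrictMonoOn (fun x => -M.marginal x) (Ioi 0) := hu.strictAntiOn_marginal.neg
  simpa only [Pi.neg_def, neg_neg] using
    (continuousOn_of_strictMonoOn_of_ordConnected_image h_neg ordConnected_Ioi h_image).neg

lemma marginalE_lt_marginalE {x y : ℝ} (hxy : x < y) (hy : 0 < y) :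
    M.marginalE y < M.marginalE x := by
  rcases le_or_gt x 0 with hx | hx
  · rw [marginalE_of_nonpos hx]
    exact (marginalE_ne_top hy).lt_top
  · rw [marginalE_of_pos hx, marginalE_of_pos hy]
    exact (ENNReal.ofReal_lt_ofReal_iff (hu.marginal_pos x hx)).2
      (hu.strictAntiOn_marginal hx hy hxy)

lemma antitone_marginalE : Antitone M.marginalE := fun x y hxy => by
  rcases le_or_gt y 0 with hy | hy
  · rw [marginalE_of_nonpos (hxy.trans hy)]
    exact le_top
  · rcases hxy.eq_or_lt with rfl | hlt
    · exact le_rfl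
    · exact (hu.marginalE_lt_marginalE hlt hy).le

lemma continuous_marginalE : Continuous M.marginalE := by
  refine continuous_iff_continuousAt.2 fun x => ?_
  rcases lt_trichotomy x 0 with hx | rfl | hx
  · refine continuousAt_const.congr (f := fun _ => ⊤) ?_
    filter_upwards [gt_mem_nhds hx] with y hy using (marginalE_of_nonpos hy.le).symm
  · rw [ContinuousAt, marginalE_of_nonpos le_rfl, ENNReal.tendsto_nhds_top_iff_nnreal]
    intro r
    filter_upwards [eventually_nhdsWithin_iff.1
      (hu.marginal_zero.eventually (eventually_gt_atTop (r : ℝ)))] with y hy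
    rcases le_or_gt y 0 with hy₀ | hy₀
    · rw [marginalE_of_nonpos hy₀]
      exact ENNReal.coe_lt_top
    · rw [marginalE_of_pos hy₀, ← ENNReal.ofReal_coe_nnreal]
      exact (ENNReal.ofReal_lt_ofReal_iff (hu.marginal_pos y hy₀)).2 (hy hy₀)
  · refine (ENNReal.continuous_ofReal.continuousAt.comp
      (hu.continuousOn_marginal.continuousAt (Ioi_mem_nhds hx))).congr ?_
    filter_upwards [lt_mem_nhds hx] with y hy using (marginalE_of_pos hy).symm

lemma measurable_marginalE : Measurable M.marginalE := hu.continuous_marginalE.measurable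

lemma marginalE_mul_le (x : ℝ≥0) : M.marginalE x * x ≤ M.marginalE x + M.marginalE 1 * x := by
  rcases le_total x 1 with h | h
  · exact le_add_right (mul_le_of_le_one_right' (by exact_mod_cast h))
  · exact le_add_left (mul_le_mul_left (hu.antitone_marginalE (by exact_mod_cast h)) _)

section Root

variable {Ψ : ℝ → ℝ≥0∞} {r : ℝ}

lemma lt_root_iff (hΨ : Monotone Ψ) (hr : 0 < r) (hroot : M.marginalE r = Ψ r) {x : ℝ} :
    x < r ↔ Ψ x < M.marginalE x := by
  refine ⟨fun h => (hΨ h.le).trans_lt (hroot ▸ hu.marginalE_lt_marginalE h hr), fun h => ?_⟩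
  by_contra! hle
  exact h.not_ge ((hu.antitone_marginalE hle).trans (hroot.trans_le (hΨ hle)))

lemma root_lt_iff (hΨ : Monotone Ψ) (hr : 0 < r) (hroot : M.marginalE r = Ψ r) {x : ℝ} :
    r < x ↔ M.marginalE x < Ψ x := by
  refine ⟨fun h => (hu.marginalE_lt_marginalE h (hr.trans h)).trans_le
    (hroot.trans_le (hΨ h.le)), fun h => ?_⟩
  by_contra! hle
  exact h.not_ge ((hΨ hle).trans (hroot.ge.trans (hu.antitone_marginalE hle)))

lemma root_unique (hΨ : Monotone Ψ) {s : ℝ} (hr : 0 < r) (hs : 0 < s)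
    (hr_root : M.marginalE r = Ψ r) (hs_root : M.marginalE s = Ψ s) : r = s := by
  refine le_antisymm (not_lt.1 fun h => ?_) (not_lt.1 fun h => ?_)
  · exact ((hu.lt_root_iff hΨ hr hr_root).1 h).ne' hs_root
  · exact ((hu.lt_root_iff hΨ hs hs_root).1 h).ne' hr_root

lemma exists_root (hΨ : Continuous Ψ) (hΨ_top : ∀ x, Ψ x ≠ ⊤) {a : ℝ} (ha : 0 < a)
    (h : M.marginalE a ≤ Ψ a) : ∃ x ∈ Ioc 0 a, M.marginalE x = Ψ x := by
  obtain ⟨x, hx, hroot⟩ := (isPreconnected_Icc (a := 0) (b := a)).intermediate_value₂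
    (right_mem_Icc.2 ha.le) (left_mem_Icc.2 ha.le) hu.continuous_marginalE.continuousOn
    hΨ.continuousOn h (by rw [marginalE_of_nonpos le_rfl]; exact le_top)
  exact ⟨x, ⟨pos_of_marginalE_ne_top (hroot ▸ hΨ_top x), hx.2⟩, hroot⟩

lemma continuous_root {X : Type*} [TopologicalSpace X] {Ψ : ℝ → X → ℝ≥0∞}
    (hmono : ∀ x, Monotone fun ξ => Ψ ξ x) (hcont : ∀ ξ, Continuous (Ψ ξ)) {r : X → ℝ}
    (hr : ∀ x, 0 < r x) (hroot : ∀ x, M.marginalE (r x) = Ψ (r x) x) : Continuous r := by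
  refine continuous_iff_continuousAt.2 fun x₀ =>
    tendsto_order.2 ⟨fun y hy => ?_, fun y hy => ?_⟩
  · filter_upwards [(hcont y).continuousAt.eventually
      (gt_mem_nhds ((hu.lt_root_iff (hmono x₀) (hr x₀) (hroot x₀)).1 hy))] with x hx
    exact (hu.lt_root_iff (hmono x) (hr x) (hroot x)).2 hx
  · filter_upwards [(hcont y).continuousAt.eventually
      (lt_mem_nhds ((hu.root_lt_iff (hmono x₀) (hr x₀) (hroot x₀)).1 hy))] with x hx
    exact (hu.root_lt_iff (hmono x) (hr x) (hroot x)).2 hx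

end Root

end InadaUtility

/-! ### Concavity of utility -/

/-- The positive part of `u`. Negative arguments are truncated to `0`. -/
def posUtility (M : IncomeFluctuation Z E H) (x : ℝ) : ℝ≥0∞ := (M.u x.toNNReal).toENNReal

/-- The negative part of `u`, with the value `∞` where `u = -∞`. Negative arguments are truncated to
`0`. -/
def negUtility (M : IncomeFluctuation Z E H) (x : ℝ) : ℝ≥0∞ := (-M.u x.toNNReal).toENNReal

/-- The sum `u⁺(y) + u⁻(x) + u'(p) x`. Comparing `crossSum p y x` with `crossSum p x y` compares
`u(y) - u'(p) y` with `u(x) - u'(p) x`, but involves no differences of infinite quantities. -/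
def crossSum (M : IncomeFluctuation Z E H) (p y x : ℝ) : ℝ≥0∞ :=
  M.posUtility y + M.negUtility x + M.marginalE p * ENNReal.ofReal x

lemma posUtility_ne_top (x : ℝ) : M.posUtility x ≠ ⊤ :=
  EReal.toENNReal_ne_top_iff.2 (M.u_ne_top _)

lemma posUtility_eq_zero_or_negUtility_eq_zero (x : ℝ) :
    M.posUtility x = 0 ∨ M.negUtility x = 0 := by
  simp only [posUtility, negUtility, EReal.toENNReal_eq_zero_iff, EReal.neg_le_zero]
  exact le_total _ _

lemma utility_eq_coe {x : ℝ} (hx : M.u x.toNNReal ≠ ⊥) :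
    M.u x.toNNReal = (M.realUtility x : EReal) :=
  (EReal.coe_toReal (M.u_ne_top _) hx).symm

lemma posUtility_eq_ofReal {x : ℝ} (hx : M.u x.toNNReal ≠ ⊥) :
    M.posUtility x = ENNReal.ofReal (M.realUtility x) := by
  rw [posUtility, utility_eq_coe hx, EReal.real_coe_toENNReal]

lemma negUtility_eq_ofReal {x : ℝ} (hx : M.u x.toNNReal ≠ ⊥) :
    M.negUtility x = ENNReal.ofReal (-M.realUtility x) := by
  rw [negUtility, utility_eq_coe hx, ← EReal.coe_neg, EReal.real_coe_toENNReal]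

namespace InadaUtility

variable (hu : M.InadaUtility)
include hu

lemma utility_ne_bot {x : ℝ} (hx : 0 < x) : M.u x.toNNReal ≠ ⊥ :=
  hu.finite _ (Real.toNNReal_pos.2 hx)

lemma negUtility_ne_top {x : ℝ} (hx : 0 < x) : M.negUtility x ≠ ⊤ := by
  rw [negUtility_eq_ofReal (hu.utility_ne_bot hx)]
  exact ENNReal.ofReal_ne_top

lemma realUtility_lt {x y : ℝ} (hx : 0 < x) (hy : 0 < y) (hxy : x ≠ y) :
    M.realUtility y < M.realUtility x + M.marginal x * (y - x) := by
  have h_concave : StrictConcaveOn ℝ (Ioi 0) M.realUtility :=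
    StrictAntiOn.strictConcaveOn_of_deriv (convex_Ioi 0)
      (fun t ht => (hu.differentiable t ht).continuousAt.continuousWithinAt)
      (by rw [interior_Ioi]; exact hu.strictAntiOn_marginal)
  exact lt_add_deriv_mul_of_strictConcaveOn h_concave hx hy hxy (hu.differentiable x hx)

lemma realUtility_le {x y : ℝ} (hx : 0 < x) (hy : 0 ≤ y) (hy_fin : M.u y.toNNReal ≠ ⊥) :
    M.realUtility y ≤ M.realUtility x + M.marginal x * (y - x) := by
  have h_pos : ∀ y, 0 < y → M.realUtility y ≤ M.realUtility x + M.marginal x * (y - x) :=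
    fun y hy => by
      rcases eq_or_ne x y with rfl | hxy
      · rw [sub_self, mul_zero, add_zero]
      · exact (hu.realUtility_lt hx hy hxy).le
  rcases hy.eq_or_lt with rfl | hy
  · have h_lim : Tendsto (fun ε : ℝ => M.realUtility x + M.marginal x * (ε - x)) (𝓝[>] 0)
        (𝓝 (M.realUtility x + M.marginal x * (0 - x))) :=
      tendsto_nhdsWithin_of_tendsto_nhds (Continuous.tendsto (by fun_prop) 0)
    refine ge_of_tendsto h_lim ?_
    filter_upwards [self_mem_nhdsWithin] with ε hε
    refine (EReal.toReal_le_toReal ?_ hy_fin (M.u_ne_top _)).trans (h_pos ε hε)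
    rw [Real.toNNReal_zero]
    exact hu.zero_le _
  · exact h_pos y hy

lemma monotone_utility : Monotone M.u := fun x y hxy => by
  rcases eq_zero_or_pos x with rfl | hx
  · exact hu.zero_le y
  have hy : 0 < y := hx.trans_le hxy
  have h_tangent := hu.realUtility_le (NNReal.coe_pos.2 hy) x.coe_nonneg
    (hu.utility_ne_bot (NNReal.coe_pos.2 hx))
  have h_slope := mul_nonneg (hu.marginal_pos y hy).le (sub_nonneg.2 (NNReal.coe_le_coe.2 hxy))
  have h_coe : ∀ w : ℝ≥0, 0 < w → M.u w = (M.realUtility w : EReal) := fun w hw => by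
    rw [← utility_eq_coe (hu.utility_ne_bot (NNReal.coe_pos.2 hw)), Real.toNNReal_coe]
  rw [h_coe x hx, h_coe y hy, EReal.coe_le_coe_iff]
  linarith

lemma crossSum_add_le {x y δ : ℝ} (hx : 0 < x) (hy : 0 ≤ y) (hy_fin : M.u y.toNNReal ≠ ⊥)
    (hδ : 0 ≤ δ) (h : M.realUtility y + δ ≤ M.realUtility x + M.marginal x * (y - x)) :
    M.crossSum x y x + ENNReal.ofReal δ ≤ M.crossSum x x y := by
  have hx_fin := hu.utility_ne_bot hx
  rw [crossSum, crossSum, posUtility_eq_ofReal hx_fin, posUtility_eq_ofReal hy_fin,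
    negUtility_eq_ofReal hx_fin, negUtility_eq_ofReal hy_fin, marginalE_of_pos hx]
  exact ofReal_add_ofReal_neg_add_le (hu.marginal_pos x hx).le hx.le hy hδ h

lemma crossSum_le {x y : ℝ} (hx : 0 ≤ x) (hy : 0 ≤ y) :
    M.crossSum x y x ≤ M.crossSum x x y := by
  rcases hx.eq_or_lt with rfl | hx
  · rcases hy.eq_or_lt with rfl | hy
    · exact le_rfl
    · rw [crossSum, crossSum, marginalE_of_nonpos le_rfl,
        ENNReal.top_mul (ENNReal.ofReal_pos.2 hy).ne', add_top]
      exact le_top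
  by_cases hbot : M.u y.toNNReal = ⊥
  · simp only [crossSum, negUtility, hbot, EReal.neg_bot, EReal.toENNReal_top, add_top, top_add,
      le_top]
  · have h_real := hu.realUtility_le hx hy hbot
    rw [← add_zero (M.realUtility y)] at h_real
    simpa only [ENNReal.ofReal_zero, add_zero] using
      hu.crossSum_add_le hx hy hbot le_rfl h_real

lemma exists_crossSum_add_le {x y : ℝ} (hx : 0 < x) (hy : 0 < y) (hxy : x ≠ y) :
    ∃ δ ≠ 0, M.crossSum x y x + δ ≤ M.crossSum x x y := by
  have h_gap := sub_pos.2 (hu.realUtility_lt hx hy hxy)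
  exact ⟨_, (ENNReal.ofReal_pos.2 h_gap).ne',
    hu.crossSum_add_le hx hy.le (hu.utility_ne_bot hy) h_gap.le (add_sub_cancel _ _).le⟩

lemma posUtility_le {y : ℝ} (hy : 0 ≤ y) :
    M.posUtility y ≤ M.posUtility 1 + M.marginalE 1 * ENNReal.ofReal y := by
  rcases M.posUtility_eq_zero_or_negUtility_eq_zero y with h | h
  · exact h.trans_le _root_.zero_le
  · have h_tangent := hu.crossSum_le zero_le_one hy
    rw [crossSum, crossSum, h, add_zero, add_assoc] at h_tangent
    exact le_self_add.trans h_tangent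

lemma negUtility_le (x : ℝ) : M.negUtility x ≤ M.negUtility 1 + M.marginalE x := by
  rcases le_or_gt x 0 with hx | hx
  · rw [marginalE_of_nonpos hx, add_top]
    exact le_top
  rcases M.posUtility_eq_zero_or_negUtility_eq_zero x with h | h
  · have h_tangent := hu.crossSum_le hx.le zero_le_one
    rw [crossSum, crossSum, h, zero_add, ENNReal.ofReal_one, mul_one] at h_tangent
    exact le_add_self.trans (le_self_add.trans h_tangent)
  · exact h.trans_le _root_.zero_le

end InadaUtility

/-! ### Policies -/

section Extend

variable {Z : Type*} {c : State Z → ℝ}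

lemma extend_of_pos {a : ℝ} (ha : 0 < a) (z : Z) : extend c a z = c (⟨a, ha⟩, z) := dif_pos ha

lemma extend_of_nonpos {a : ℝ} (ha : a ≤ 0) (z : Z) : extend c a z = 0 := dif_neg ha.not_gt

lemma extend_nonneg (hc : ∀ s, 0 ≤ c s) (a : ℝ) (z : Z) : 0 ≤ extend c a z := by
  rcases le_or_gt a 0 with ha | ha
  · rw [extend_of_nonpos ha]
  · rw [extend_of_pos ha]
    exact hc _

lemma extend_le_max (hc : ∀ s, c s ≤ s.1) (a : ℝ) (z : Z) : extend c a z ≤ max a 0 := by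
  rcases le_or_gt a 0 with ha | ha
  · rw [extend_of_nonpos ha]
    exact le_max_right _ _
  · rw [extend_of_pos ha]
    exact (hc _).trans (le_max_left _ _)

lemma measurable_extend [MeasurableSpace Z] (hc : Measurable c) :
    Measurable fun p : ℝ × Z => extend c p.1 p.2 := by
  have h_pos : MeasurableSet {p : ℝ × Z | 0 < p.1} :=
    measurableSet_lt measurable_const measurable_fst
  refine Measurable.dite (s := {p : ℝ × Z | 0 < p.1})
    (f := fun p => c (⟨p.1.1, p.2⟩, p.1.2)) (g := fun _ => 0) ?_ measurable_const h_pos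
  exact hc.comp ((measurable_fst.comp measurable_subtype_coe).subtype_mk.prodMk
    (measurable_snd.comp measurable_subtype_coe))

end Extend

namespace Candidate

@[ext]
lemma ext {c d : M.Candidate} (h : ∀ s, c.toFun s = d.toFun s) : c = d := by
  obtain ⟨f⟩ := c
  obtain ⟨g⟩ := d
  obtain rfl : f = g := funext h
  rfl

instance : Nonempty M.Candidate :=
  ⟨{ toFun := fun s => s.1
     continuous := by fun_prop
     monotone := fun _ _ _ h => h
     pos := fun s => s.1.2
     le_assets := fun _ => le_rfl
     bounded := ⟨0, fun s => by rw [sub_self, abs_zero]⟩ }⟩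

variable (c : M.Candidate)

lemma isFeasible [OpensMeasurableSpace (State Z)] : IsFeasible c.toFun :=
  ⟨c.continuous.measurable, fun s => ⟨(c.pos s).le, c.le_assets s⟩⟩

lemma extend_pos {a : ℝ} (ha : 0 < a) (z : Z) : 0 < extend c.toFun a z := by
  rw [extend_of_pos ha]
  exact c.pos _

lemma monotone_extend (z : Z) : Monotone fun a => extend c.toFun a z := fun a b hab => by
  rcases le_or_gt a 0 with ha | ha
  · simp only [extend_of_nonpos ha]
    exact extend_nonneg (fun s => (c.pos s).le) b z
  · simp only [extend_of_pos ha, extend_of_pos (ha.trans_le hab)]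
    exact c.monotone z hab

lemma continuous_extend : Continuous fun p : ℝ × Z => extend c.toFun p.1 p.2 := by
  refine continuous_iff_continuousAt.2 fun ⟨a, z⟩ => ?_
  rcases le_or_gt a 0 with ha | ha
  · have h_max : Tendsto (fun p : ℝ × Z => max p.1 0) (𝓝 (a, z)) (𝓝 0) := by
      simpa only [max_eq_right ha] using
        Continuous.tendsto (f := fun p : ℝ × Z => max p.1 0) (by fun_prop) (a, z)
    rw [ContinuousAt, extend_of_nonpos ha]
    exact squeeze_zero (fun p => extend_nonneg (fun s => (c.pos s).le) _ _)
      (fun p => extend_le_max c.le_assets _ _) h_max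
  · have h_open : IsOpen {p : ℝ × Z | 0 < p.1} := isOpen_lt continuous_const continuous_fst
    have h_on : ContinuousOn (fun p : ℝ × Z => extend c.toFun p.1 p.2) {p | 0 < p.1} := by
      rw [continuousOn_iff_continuous_domRestrict]
      refine (c.continuous.comp (g := c.toFun)
        (f := fun p : {p : ℝ × Z | 0 < p.1} => (⟨p.1.1, p.2⟩, p.1.2)) (by fun_prop)).congr ?_
      exact fun p => (extend_of_pos p.2 _).symm
    exact h_on.continuousAt (h_open.mem_nhds ha)

end Candidate

/-! ### The metric space of candidate policies -/

namespace InadaUtility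

variable (hu : M.InadaUtility)
include hu

lemma ofReal_abs_marginal_sub_le_iff {x y : ℝ} (hx : 0 < x) (hy : 0 < y) {r : ℝ≥0∞} :
    ENNReal.ofReal |M.marginal x - M.marginal y| ≤ r ↔
      M.marginalE x ≤ M.marginalE y + r ∧ M.marginalE y ≤ M.marginalE x + r := by
  rw [marginalE_of_pos hx, marginalE_of_pos hy, ← tsub_le_iff_left, ← tsub_le_iff_left,
    ← ENNReal.ofReal_sub _ (hu.marginal_pos y hy).le,
    ← ENNReal.ofReal_sub _ (hu.marginal_pos x hx).le, ← max_le_iff, ← ENNReal.ofReal_max,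
    abs_eq_max_neg, neg_sub]

lemma continuous_marginal_comp {X : Type*} [TopologicalSpace X] {f : X → ℝ} (hf : Continuous f)
    (hf_pos : ∀ x, 0 < f x) : Continuous fun x => M.marginal (f x) :=
  hu.continuousOn_marginal.comp_continuous hf hf_pos

end InadaUtility

namespace Candidate

section Excess

variable (hu : M.InadaUtility)

/-- `u' ∘ c - u'` as a bounded continuous function. The distance `ρ` is the uniform distance between
these functions. -/
def excess (c : M.Candidate) : State Z →ᵇ ℝ :=
  BoundedContinuousFunction.ofNormedAddCommGroup
    (fun s => M.marginal (c.toFun s) - M.marginal s.1)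
    ((hu.continuous_marginal_comp c.continuous c.pos).sub
      (hu.continuous_marginal_comp (by fun_prop) fun s => s.1.2))
    c.bounded.choose c.bounded.choose_spec

lemma excess_apply (c : M.Candidate) (s : State Z) :
    c.excess hu s = M.marginal (c.toFun s) - M.marginal s.1 := rfl

lemma injective_excess : Function.Injective fun c : M.Candidate => c.excess hu := by
  intro c d h
  ext s
  have h_apply : c.excess hu s = d.excess hu s := DFunLike.congr_fun h s
  rw [excess_apply, excess_apply] at h_apply
  exact hu.strictAntiOn_marginal.injOn (c.pos s) (d.pos s) (sub_left_injective h_apply)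

lemma edist_excess (c d : M.Candidate) : edist (c.excess hu) (d.excess hu) = rho c d := by
  rw [BoundedContinuousFunction.edist_eq_iSup, rho]
  refine iSup_congr fun s => ?_
  rw [edist_dist, Real.dist_eq, excess_apply, excess_apply, sub_sub_sub_cancel_right]

end Excess

section Metric

variable (hu : M.InadaUtility)
include hu

lemma rho_le_iff {c d : M.Candidate} {r : ℝ≥0∞} :
    rho c d ≤ r ↔ ∀ s, M.marginalE (c.toFun s) ≤ M.marginalE (d.toFun s) + r ∧
      M.marginalE (d.toFun s) ≤ M.marginalE (c.toFun s) + r := by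
  rw [rho, iSup_le_iff]
  exact forall_congr' fun s => hu.ofReal_abs_marginal_sub_le_iff (c.pos s) (d.pos s)

lemma exists_marginalE_extend_le (c : M.Candidate) :
    ∃ K : ℝ≥0, ∀ a z, M.marginalE (extend c.toFun a z) ≤ M.marginalE a + K := by
  obtain ⟨K, hK⟩ := c.bounded
  refine ⟨K.toNNReal, fun a z => ?_⟩
  rcases le_or_gt a 0 with ha | ha
  · rw [marginalE_of_nonpos ha, top_add]
    exact le_top
  · rw [extend_of_pos ha]
    exact ((hu.ofReal_abs_marginal_sub_le_iff (c.pos (⟨a, ha⟩, z)) ha).1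
      (ENNReal.ofReal_le_ofReal (hK _))).1

lemma exists_marginalE_eq {Ψ : ℝ → State Z → ℝ≥0∞} (h_mono : ∀ s, Monotone fun ξ => Ψ ξ s)
    (h_anti : ∀ ξ z, Antitone fun a : Ioi (0 : ℝ) => Ψ ξ (a, z))
    (h_cont : Continuous (Function.uncurry Ψ)) (h_lower : ∀ ξ s, M.marginalE s.1 ≤ Ψ ξ s)
    {B : ℝ≥0} (h_upper : ∀ ξ s, Ψ ξ s ≤ M.marginalE s.1 + B) :
    ∃ c : M.Candidate, ∀ s, M.marginalE (c.toFun s) = Ψ (c.toFun s) s := by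
  have h_top : ∀ ξ s, Ψ ξ s ≠ ⊤ := fun ξ s => ne_top_of_le_ne_top
    (ENNReal.add_ne_top.2 ⟨marginalE_ne_top s.1.2, ENNReal.coe_ne_top⟩) (h_upper ξ s)
  choose r hr h_root using fun s : State Z =>
    hu.exists_root (h_cont.comp (by fun_prop : Continuous fun ξ => (ξ, s))) (h_top · s) s.1.2
      (h_lower _ s)
  refine ⟨{ toFun := r
            continuous := hu.continuous_root h_mono
              (fun ξ => h_cont.comp (by fun_prop : Continuous fun s => (ξ, s)))
              (fun s => (hr s).1) h_root
            monotone := fun z a b hab => not_lt.1 fun h_lt => ?_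
            pos := fun s => (hr s).1
            le_assets := fun s => (hr s).2
            bounded := ⟨B, fun s => ?_⟩ }, h_root⟩
  · refine (((hu.lt_root_iff (h_mono _) (hr (a, z)).1 (h_root _)).1 h_lt).trans_le ?_).not_ge
      (h_anti _ z hab)
    exact (h_root (b, z)).le
  · rw [← ENNReal.ofReal_le_ofReal_iff B.coe_nonneg, ENNReal.ofReal_coe_nnreal]
    exact (hu.ofReal_abs_marginal_sub_le_iff (hr s).1 s.1.2).2
      ⟨(h_root s).trans_le (h_upper _ s), le_add_right (hu.antitone_marginalE (hr s).2)⟩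

lemma range_excess :
    range (fun c : M.Candidate => c.excess hu) =
      {h | (∀ s, 0 ≤ h s) ∧ ∀ (z : Z) (a b : Ioi (0 : ℝ)), a ≤ b →
        h (b, z) + M.marginal b ≤ h (a, z) + M.marginal a} := by
  ext h
  constructor
  · rintro ⟨c, rfl⟩
    have h_anti := hu.strictAntiOn_marginal.antitoneOn
    refine ⟨fun s => sub_nonneg.2 (h_anti (c.pos s) s.1.2 (c.le_assets s)), fun z a b hab => ?_⟩
    simpa only [excess_apply, sub_add_cancel] using
      h_anti (c.pos (a, z)) (c.pos (b, z)) (c.monotone z hab)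
  · rintro ⟨h_nonneg, h_anti⟩
    have h_norm : ∀ s, h s ≤ ‖h‖₊ := fun s => (le_abs_self _).trans (h.norm_coe_le_norm s)
    have h_cont : Continuous fun s : State Z => M.marginal s.1 :=
      hu.continuous_marginal_comp (by fun_prop) fun s => s.1.2
    obtain ⟨c, hc⟩ := exists_marginalE_eq hu (B := ‖h‖₊)
      (Ψ := fun _ s => ENNReal.ofReal (h s + M.marginal s.1)) (fun _ => monotone_const)
      (fun _ z a b hab => ENNReal.ofReal_le_ofReal (h_anti z a b hab))
      (ENNReal.continuous_ofReal.comp ((h.continuous.add h_cont).comp continuous_snd))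
      (fun _ s => (marginalE_of_pos s.1.2).trans_le
        (ENNReal.ofReal_le_ofReal (le_add_of_nonneg_left (h_nonneg s))))
      (fun _ s => by
        rw [marginalE_of_pos s.1.2, add_comm (h s), ← ENNReal.ofReal_coe_nnreal]
        exact (ENNReal.ofReal_le_ofReal (add_le_add_right (h_norm s) _)).trans
          ENNReal.ofReal_add_le)
    refine ⟨c, BoundedContinuousFunction.ext fun s => ?_⟩
    have h_eq := hc s
    rw [marginalE_of_pos (c.pos s), ENNReal.ofReal_eq_ofReal_iff (hu.marginal_pos _ (c.pos s)).le
      (add_nonneg (h_nonneg s) (hu.marginal_pos _ s.1.2).le)] at h_eq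
    exact sub_eq_of_eq_add h_eq

lemma isClosed_range_excess : IsClosed (range fun c : M.Candidate => c.excess hu) := by
  have h_eval : ∀ s : State Z, Continuous fun h : State Z →ᵇ ℝ => h s := fun s => by fun_prop
  rw [range_excess hu]
  simp only [ofPred_and, ofPred_forall]
  refine (isClosed_iInter fun s => isClosed_le continuous_const (h_eval s)).inter ?_
  refine isClosed_iInter fun z => isClosed_iInter fun a => isClosed_iInter fun b =>
    isClosed_iInter fun _ => ?_
  exact isClosed_le ((h_eval _).add continuous_const) ((h_eval _).add continuous_const)

theorem exists_completeSpace :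
    ∃ D : MetricSpace M.Candidate, (∀ c d : M.Candidate, edist c d = rho c d) ∧
      @CompleteSpace M.Candidate D.toUniformSpace := by
  let D : MetricSpace M.Candidate :=
    MetricSpace.induced (fun c => c.excess hu) (injective_excess hu) inferInstance
  have h_isometry : Isometry fun c : M.Candidate => c.excess hu := fun _ _ => rfl
  exact ⟨D, edist_excess hu, (completeSpace_iff_isComplete_range h_isometry.isUniformInducing).2
    (isClosed_range_excess hu).isComplete⟩

end Metric

end Candidate

/-! ### Expectations over next period's shocks -/

lemma lintegral_shockKernel {f : Z × E × H → ℝ≥0∞} (hf : Measurable f) (z : Z) :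
    ∫⁻ w, f w ∂M.shockKernel z = ∫⁻ y, ∫⁻ e, f (y, e) ∂M.ν.prod M.μ ∂M.P z := by
  rw [shockKernel, Kernel.prod_apply, Kernel.const_apply, lintegral_prod _ hf.aemeasurable]

lemma measurable_return : Measurable fun w : Z × E × H => M.R (w.1, w.2.1) :=
  M.measurable_R.comp (by fun_prop)

lemma measurable_income : Measurable fun w : Z × E × H => M.Y (w.1, w.2.2) :=
  M.measurable_Y.comp (by fun_prop)

section Continuity

variable [TopologicalSpace.PseudoMetrizableSpace Z] [BorelSpace Z]
  {X : Type*} [TopologicalSpace X] [TopologicalSpace.PseudoMetrizableSpace X]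

lemma lowerSemicontinuous_lintegral_shockKernel {f : X → Z × E × H → ℝ≥0∞}
    (hm : ∀ x, Measurable (f x))
    (hf : ∀ e : E × H, LowerSemicontinuous fun p : X × Z => f p.1 (p.2, e)) :
    LowerSemicontinuous fun p : X × Z => ∫⁻ w, f p.1 w ∂M.shockKernel p.2 := by
  simp_rw [lintegral_shockKernel (hm _)]
  exact lowerSemicontinuous_lintegral_of_feller M.P M.feller
    (F := fun p : X × Z => ∫⁻ e, f p.1 (p.2, e) ∂M.ν.prod M.μ)
    (lowerSemicontinuous_lintegral _
      (fun p => (hm p.1).comp (measurable_const.prodMk measurable_id)) hf)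

lemma lowerSemicontinuous_lintegral_shockKernel_mul {r : Z × E × H → ℝ≥0}
    {f : X → Z × E × H → ℝ≥0∞} (hrm : Measurable r) (hfm : ∀ x, Measurable (f x))
    (hr : ∀ e : E × H, Continuous fun z => r (z, e))
    (hf : ∀ (e : E × H) (p : X × Z), f p.1 (p.2, e) = 0 ∨
      ContinuousAt (fun p : X × Z => f p.1 (p.2, e)) p) :
    LowerSemicontinuous fun p : X × Z => ∫⁻ w, r w * f p.1 w ∂M.shockKernel p.2 := by
  refine lowerSemicontinuous_lintegral_shockKernel (f := fun x w => r w * f x w)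
    (fun x => hrm.coe_nnreal_ennreal.mul (hfm x)) fun e =>
      lowerSemicontinuous_of_eq_zero_or_continuousAt fun p => ?_
  by_cases hrp : (r (p.2, e) : ℝ≥0∞) = 0
  · exact .inl (by rw [hrp, zero_mul])
  rcases hf e p with h_zero | h_cont
  · exact .inl (by rw [h_zero, mul_zero])
  · have hr_cont : Continuous fun p : X × Z => (r (p.2, e) : ℝ≥0∞) :=
      ENNReal.continuous_coe.comp ((hr e).comp continuous_snd)
    exact .inr (ENNReal.Tendsto.mul (hr_cont.tendsto p) (.inl hrp) h_cont (.inr ENNReal.coe_ne_top))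

/-- Dominated convergence for the varying measures `M.shockKernel z`: both `r f` and `r (g - f)`
have lower semicontinuous integrals, and these integrals sum to a continuous function. -/
theorem continuous_lintegral_shockKernel_mul {r : Z × E × H → ℝ≥0} {f : X → Z × E × H → ℝ≥0∞}
    {g : Z × E × H → ℝ≥0∞} (hrm : Measurable r) (hfm : ∀ x, Measurable (f x)) (hgm : Measurable g)
    (hr : ∀ e : E × H, Continuous fun z => r (z, e))
    (hf : ∀ e : E × H, Continuous fun p : X × Z => f p.1 (p.2, e))
    (hg : ∀ e : E × H, Continuous fun z => g (z, e)) (hfg : ∀ x w, f x w ≤ g w)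
    (h_cont : Continuous fun z => ∫⁻ w, r w * g w ∂M.shockKernel z)
    (h_top : ∀ z, ∫⁻ w, r w * g w ∂M.shockKernel z ≠ ⊤) :
    Continuous fun p : X × Z => ∫⁻ w, r w * f p.1 w ∂M.shockKernel p.2 := by
  have h_lower : LowerSemicontinuous fun p : X × Z => ∫⁻ w, r w * f p.1 w ∂M.shockKernel p.2 :=
    lowerSemicontinuous_lintegral_shockKernel_mul hrm hfm hr fun e p => .inr (hf e).continuousAt
  have h_lower_sub : LowerSemicontinuous fun p : X × Z =>
      ∫⁻ w, r w * (g w - f p.1 w) ∂M.shockKernel p.2 := by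
    refine lowerSemicontinuous_lintegral_shockKernel_mul (f := fun x w => g w - f x w) hrm
      (fun x => hgm.sub (hfm x)) hr fun e p => ?_
    by_cases hfp : f p.1 (p.2, e) = ⊤
    · exact .inl (by rw [hfp, tsub_eq_zero_of_le le_top])
    · exact .inr (ENNReal.Tendsto.sub (((hg e).comp continuous_snd).tendsto p) ((hf e).tendsto p)
        (.inr hfp))
  refine continuous_of_lowerSemicontinuous_of_add_eq h_lower h_lower_sub
    (h_cont.comp continuous_snd) (fun p => h_top p.2) fun p => ?_
  have h_meas : Measurable fun w => r w * f p.1 w := hrm.coe_nnreal_ennreal.mul (hfm p.1)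
  rw [← lintegral_add_left h_meas]
  refine lintegral_congr fun w => ?_
  rw [← mul_add, add_tsub_cancel_of_le (hfg p.1 w)]

end Continuity

/-- The operator `γ ↦ E_z R̂ γ(ẑ)`. -/
def returnOp (M : IncomeFluctuation Z E H) (γ : Z → ℝ≥0∞) (z : Z) : ℝ≥0∞ :=
  ∫⁻ w, M.R (w.1, w.2.1) * γ w.1 ∂M.shockKernel z

lemma measurable_return_mul {γ : Z → ℝ≥0∞} (hγ : Measurable γ) :
    Measurable fun w : Z × E × H => M.R (w.1, w.2.1) * γ w.1 :=
  measurable_return.coe_nnreal_ennreal.mul (hγ.comp measurable_fst)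

lemma measurable_returnOp {γ : Z → ℝ≥0∞} (hγ : Measurable γ) : Measurable (M.returnOp γ) :=
  (measurable_return_mul hγ).lintegral_kernel

lemma measurable_returnOp_iterate {γ : Z → ℝ≥0∞} (hγ : Measurable γ) (k : ℕ) :
    Measurable (M.returnOp^[k] γ) :=
  Function.Iterate.rec (fun γ => Measurable γ) hγ (fun _ => measurable_returnOp) k

lemma monotone_returnOp : Monotone M.returnOp := fun γ δ h z =>
  lintegral_mono fun w => by
    gcongr
    exact h w.1

lemma returnOp_const_mul (r : ℝ≥0∞) {γ : Z → ℝ≥0∞} (hγ : Measurable γ) :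
    M.returnOp (fun z => r * γ z) = fun z => r * M.returnOp γ z := by
  funext z
  simp only [returnOp, mul_left_comm _ r]
  exact lintegral_const_mul r (measurable_return_mul hγ)

lemma returnOp_iterate_const_mul (r : ℝ≥0∞) {γ : Z → ℝ≥0∞} (hγ : Measurable γ) (k : ℕ) :
    M.returnOp^[k] (fun z => r * γ z) = fun z => r * (M.returnOp^[k] γ) z := by
  induction k with
  | zero => rfl
  | succ k ih =>
    rw [Function.iterate_succ_apply', ih, Function.iterate_succ_apply',
      returnOp_const_mul r (measurable_returnOp_iterate hγ k)]

lemma returnOp_one : M.returnOp (fun _ => 1) = M.meanReturn := by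
  funext z
  simp only [returnOp, meanReturn, mul_one]

/-! ### The right-hand side of the Euler equation -/

/-- `E_z R̂ (u' ∘ c)(R̂ x + Ŷ, ẑ)`: the marginal value of savings `x` when next period's consumption
is given by `c`. -/
def eulerMean (M : IncomeFluctuation Z E H) (c : State Z → ℝ) (x : ℝ) (z : Z) : ℝ≥0∞ :=
  ∫⁻ w, M.R (w.1, w.2.1) *
    M.marginalE (extend c (M.R (w.1, w.2.1) * x + M.Y (w.1, w.2.2)) w.1) ∂M.shockKernel z

lemma psi_eq_max_eulerMean (c : State Z → ℝ) (ξ a : ℝ) (z : Z) :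
    M.psi c ξ a z = max (M.β * M.eulerMean c (a - ξ) z) (M.marginalE a) := rfl

lemma eulerMean_le_add_returnOp {c d : State Z → ℝ} {γ : Z → ℝ≥0∞} (hγ : Measurable γ)
    (h : ∀ s, M.marginalE (c s) ≤ M.marginalE (d s) + γ s.2) (x : ℝ) (z : Z) :
    M.eulerMean c x z ≤ M.eulerMean d x z + M.returnOp γ z := by
  have h_extend : ∀ a z, M.marginalE (extend c a z) ≤ M.marginalE (extend d a z) + γ z := by
    intro a z
    rcases le_or_gt a 0 with ha | ha
    · rw [extend_of_nonpos ha, extend_of_nonpos ha]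
      exact le_self_add
    · rw [extend_of_pos ha, extend_of_pos ha]
      exact h _
  rw [eulerMean, eulerMean, returnOp, ← lintegral_add_right _ (measurable_return_mul hγ)]
  refine lintegral_mono fun w => ?_
  rw [← mul_add]
  exact mul_le_mul_right (h_extend _ _) _

lemma measurable_next_assets (x : ℝ) :
    Measurable fun w : Z × E × H => M.R (w.1, w.2.1) * x + M.Y (w.1, w.2.2) :=
  (measurable_return.coe_nnreal_real.mul_const x).add measurable_income.coe_nnreal_real

namespace InadaUtility

variable (hu : M.InadaUtility)
include hu

lemma measurable_marginalE_income :
    Measurable fun w : Z × E × H => M.marginalE (M.Y (w.1, w.2.2)) :=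
  hu.measurable_marginalE.comp measurable_income.coe_nnreal_real

lemma lintegral_return_mul_marginalE_income_add (K : ℝ≥0) (z : Z) :
    ∫⁻ w, M.R (w.1, w.2.1) * (M.marginalE (M.Y (w.1, w.2.2)) + K) ∂M.shockKernel z =
      M.meanReturnMarginalIncome z + K * M.meanReturn z := by
  have h_meas : Measurable fun w : Z × E × H =>
      M.R (w.1, w.2.1) * M.marginalE (M.Y (w.1, w.2.2)) :=
    measurable_return.coe_nnreal_ennreal.mul hu.measurable_marginalE_income
  simp only [mul_add]
  rw [lintegral_add_left h_meas, lintegral_mul_const _ measurable_return.coe_nnreal_ennreal,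
    mul_comm (K : ℝ≥0∞)]
  rfl

end InadaUtility

lemma MomentAssumption.exists_meanReturnMarginalIncome_add_le (hmom : M.MomentAssumption)
    (K : ℝ≥0) : ∃ B : ℝ≥0, ∀ z, M.meanReturnMarginalIncome z + K * M.meanReturn z ≤ B := by
  have h_top : (⨆ z, M.meanReturnMarginalIncome z) + K * ⨆ z, M.meanReturn z ≠ ⊤ :=
    ENNReal.add_ne_top.2 ⟨hmom.mean_return_marginal.ne,
      ENNReal.mul_ne_top ENNReal.coe_ne_top hmom.mean_return.ne⟩
  refine ⟨_, fun z => (?_ : _ ≤ _).trans_eq (ENNReal.coe_toNNReal h_top).symm⟩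
  gcongr
  · exact le_iSup M.meanReturnMarginalIncome z
  · exact le_iSup M.meanReturn z

namespace Candidate

variable (hu : M.InadaUtility) (c : M.Candidate)
include hu

lemma antitone_eulerMean (z : Z) : Antitone fun x => M.eulerMean c.toFun x z := fun x y hxy =>
  lintegral_mono fun w => by
    gcongr
    refine hu.antitone_marginalE (c.monotone_extend _ ?_)
    gcongr

variable {c} {K : ℝ≥0} (hK : ∀ a z, M.marginalE (extend c.toFun a z) ≤ M.marginalE a + K)
include hK

lemma marginalE_extend_next_assets_le (x : ℝ≥0) (w : Z × E × H) :
    M.marginalE (extend c.toFun (M.R (w.1, w.2.1) * x + M.Y (w.1, w.2.2)) w.1) ≤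
      M.marginalE (M.Y (w.1, w.2.2)) + K :=
  (hK _ _).trans (add_le_add_left (hu.antitone_marginalE
    (le_add_of_nonneg_left (mul_nonneg NNReal.zero_le_coe NNReal.zero_le_coe))) _)

lemma eulerMean_le (x : ℝ≥0) (z : Z) :
    M.eulerMean c.toFun x z ≤ M.meanReturnMarginalIncome z + K * M.meanReturn z := by
  rw [← hu.lintegral_return_mul_marginalE_income_add]
  exact lintegral_mono fun w => mul_le_mul_right (marginalE_extend_next_assets_le hu hK x w) _

omit hK
variable (c) [TopologicalSpace.PseudoMetrizableSpace Z] [BorelSpace Z]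

theorem continuous_eulerMean (hmom : M.MomentAssumption) (hcont : M.ContinuityAssumption) :
    Continuous fun p : ℝ≥0 × Z => M.eulerMean c.toFun p.1 p.2 := by
  obtain ⟨K, hK⟩ := exists_marginalE_extend_le hu c
  obtain ⟨B, hB⟩ := hmom.exists_meanReturnMarginalIncome_add_le K
  have hR : ∀ e : E × H, Continuous fun z => M.R (z, e.1) := fun e => hcont.continuous_R e.1
  have hY : ∀ e : E × H, Continuous fun z => (M.Y (z, e.2) : ℝ) := fun e =>
    NNReal.continuous_coe.comp (hcont.continuous_Y e.2)
  refine continuous_lintegral_shockKernel_mul (r := fun w => M.R (w.1, w.2.1))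
    (f := fun (x : ℝ≥0) w =>
      M.marginalE (extend c.toFun (M.R (w.1, w.2.1) * x + M.Y (w.1, w.2.2)) w.1))
    (g := fun w => M.marginalE (M.Y (w.1, w.2.2)) + K) measurable_return (fun x => ?_)
    (hu.measurable_marginalE_income.add_const _) hR (fun e => ?_) (fun e => ?_)
    (marginalE_extend_next_assets_le hu hK) ?_ fun z => ?_
  · exact hu.measurable_marginalE.comp (c.continuous_extend.measurable.comp
      ((measurable_next_assets x).prodMk measurable_fst))
  · exact hu.continuous_marginalE.comp (c.continuous_extend.comp
      ((((NNReal.continuous_coe.comp ((hR e).comp continuous_snd)).mul (by fun_prop)).add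
        ((hY e).comp continuous_snd)).prodMk continuous_snd))
  · exact (hu.continuous_marginalE.comp (hY e)).add continuous_const
  · rw [funext (hu.lintegral_return_mul_marginalE_income_add K)]
    exact hcont.continuous_meanReturnMarginal.add
      ((ENNReal.continuous_const_mul ENNReal.coe_ne_top).comp hcont.continuous_meanReturn)
  · rw [hu.lintegral_return_mul_marginalE_income_add]
    exact ne_top_of_le_ne_top ENNReal.coe_ne_top (hB z)

end Candidate

/-! ### The Coleman operator -/

/-- `M.psi` with savings `a - ξ` truncated at `0`, hence bounded and continuous in all variables. -/
def psiTrunc (M : IncomeFluctuation Z E H) (c : State Z → ℝ) (ξ : ℝ) (s : State Z) : ℝ≥0∞ :=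
  max (M.β * M.eulerMean c (s.1 - ξ).toNNReal s.2) (M.marginalE s.1)

lemma psiTrunc_eq_psi (c : State Z → ℝ) {ξ : ℝ} {s : State Z} (h : ξ ≤ s.1) :
    M.psiTrunc c ξ s = M.psi c ξ s.1 s.2 := by
  rw [psiTrunc, psi_eq_max_eulerMean, Real.coe_toNNReal _ (sub_nonneg.2 h)]

namespace Candidate

variable (hu : M.InadaUtility) (c : M.Candidate)
include hu

lemma monotone_psi (a : ℝ) (z : Z) : Monotone fun ξ => M.psi c.toFun ξ a z := fun ξ ξ' h => by
  simp only [psi_eq_max_eulerMean]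
  gcongr
  exact antitone_eulerMean hu c z (sub_le_sub_left h a)

lemma monotone_psiTrunc (s : State Z) : Monotone fun ξ => M.psiTrunc c.toFun ξ s :=
  fun ξ ξ' h => by
    simp only [psiTrunc]
    gcongr
    refine antitone_eulerMean hu c s.2 ?_
    gcongr

lemma antitone_psiTrunc (ξ : ℝ) (z : Z) :
    Antitone fun a : Ioi (0 : ℝ) => M.psiTrunc c.toFun ξ (a, z) := fun a b h => by
  have hab : (a : ℝ) ≤ b := h
  refine max_le_max ?_ (hu.antitone_marginalE hab)
  gcongr
  refine antitone_eulerMean hu c z ?_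
  gcongr

lemma exists_psiTrunc_le (hmom : M.MomentAssumption) :
    ∃ B : ℝ≥0, ∀ ξ s, M.psiTrunc c.toFun ξ s ≤ M.marginalE s.1 + B := by
  obtain ⟨K, hK⟩ := exists_marginalE_extend_le hu c
  obtain ⟨B, hB⟩ := hmom.exists_meanReturnMarginalIncome_add_le K
  refine ⟨M.β * B, fun ξ s => max_le (le_add_left ?_) le_self_add⟩
  rw [ENNReal.coe_mul]
  gcongr
  exact (eulerMean_le hu hK _ _).trans (hB _)

variable [TopologicalSpace.PseudoMetrizableSpace Z] [BorelSpace Z]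

lemma continuous_psiTrunc (hmom : M.MomentAssumption) (hcont : M.ContinuityAssumption) :
    Continuous (Function.uncurry (M.psiTrunc c.toFun)) := by
  have h_savings : Continuous fun p : ℝ × State Z => ((p.2.1 - p.1).toNNReal, p.2.2) := by fun_prop
  exact ((ENNReal.continuous_const_mul ENNReal.coe_ne_top).comp
    ((continuous_eulerMean hu c hmom hcont).comp h_savings)).max
      (hu.continuous_marginalE.comp (by fun_prop))

end Candidate

theorem exists_isColeman [TopologicalSpace.PseudoMetrizableSpace Z] [BorelSpace Z]
    (hu : M.InadaUtility) (hmom : M.MomentAssumption) (hcont : M.ContinuityAssumption) :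
    ∃ T : M.Candidate → M.Candidate, M.IsColeman T := by
  choose T hT using fun c : M.Candidate =>
    Candidate.exists_marginalE_eq hu (c.monotone_psiTrunc hu) (c.antitone_psiTrunc hu)
      (c.continuous_psiTrunc hu hmom hcont) (fun _ _ => le_max_right _ _)
      (c.exists_psiTrunc_le hu hmom).choose_spec
  have h_root : ∀ c s, M.marginalE ((T c).toFun s) = M.psi c.toFun ((T c).toFun s) s.1 s.2 :=
    fun c s => (hT c s).trans (psiTrunc_eq_psi _ ((T c).le_assets s))
  refine ⟨T, fun c s ξ => ⟨fun ⟨hξ, hξ_root⟩ => ?_, ?_⟩⟩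
  · exact hu.root_unique (c.monotone_psi hu s.1 s.2) hξ.1 ((T c).pos s) hξ_root (h_root c s)
  · rintro rfl
    exact ⟨⟨(T c).pos s, (T c).le_assets s⟩, h_root c s⟩

namespace IsColeman

variable {T : M.Candidate → M.Candidate} (hT : M.IsColeman T)
include hT

lemma marginalE_apply (c : M.Candidate) (s : State Z) :
    M.marginalE ((T c).toFun s) = M.psi c.toFun ((T c).toFun s) s.1 s.2 :=
  ((hT c s _).2 rfl).2

variable (hu : M.InadaUtility) {c d : M.Candidate}
include hu

/-- Where `T c < T d`, the right-hand sides are compared at the same consumption level `T c`. -/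
lemma marginalE_apply_le {γ : Z → ℝ≥0∞} (hγ : Measurable γ)
    (h : ∀ s, M.marginalE (c.toFun s) ≤ M.marginalE (d.toFun s) + γ s.2) (s : State Z) :
    M.marginalE ((T c).toFun s) ≤ M.marginalE ((T d).toFun s) + M.β * M.returnOp γ s.2 := by
  rcases le_or_gt ((T d).toFun s) ((T c).toFun s) with h_le | h_lt
  · exact le_add_right (hu.antitone_marginalE h_le)
  calc M.marginalE ((T c).toFun s)
      = M.psi c.toFun ((T c).toFun s) s.1 s.2 := hT.marginalE_apply c s
    _ ≤ M.psi d.toFun ((T c).toFun s) s.1 s.2 + M.β * M.returnOp γ s.2 := by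
        rw [psi_eq_max_eulerMean, psi_eq_max_eulerMean, ← max_add_add_right, ← mul_add]
        exact max_le_max (mul_le_mul_right (eulerMean_le_add_returnOp hγ h _ _) _) le_self_add
    _ ≤ M.psi d.toFun ((T d).toFun s) s.1 s.2 + M.β * M.returnOp γ s.2 :=
        add_le_add_left (d.monotone_psi hu s.1 s.2 h_lt.le) _
    _ = M.marginalE ((T d).toFun s) + M.β * M.returnOp γ s.2 := by rw [hT.marginalE_apply d s]

theorem marginalE_iterate_le {r : ℝ≥0∞}
    (h : ∀ s, M.marginalE (c.toFun s) ≤ M.marginalE (d.toFun s) + r) (k : ℕ) (s : State Z) :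
    M.marginalE ((T^[k] c).toFun s) ≤
      M.marginalE ((T^[k] d).toFun s) + r * M.β ^ k * (M.returnOp^[k] fun _ => 1) s.2 := by
  induction k generalizing s with
  | zero => simpa only [Function.iterate_zero, id, pow_zero, mul_one] using h s
  | succ k ih =>
    have h_meas := measurable_returnOp_iterate (M := M) (γ := fun _ => 1) measurable_const k
    simp only [Function.iterate_succ_apply']
    refine (hT.marginalE_apply_le hu (h_meas.const_mul _) ih s).trans_eq ?_
    rw [returnOp_const_mul _ h_meas]
    ring

end IsColeman

/-! ### Discounted expectations along paths -/

instance (z : Z) : IsProbabilityMeasure (M.pathLaw z) := by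
  unfold pathLaw
  infer_instance

lemma lintegral_pathLaw_zero {f : Z × E × H → ℝ≥0∞} (hf : Measurable f) (z : Z) :
    ∫⁻ ω, f (ω 0) ∂M.pathLaw z = ∫⁻ e, f (z, e) ∂M.ν.prod M.μ := by
  have h_meas : Measurable fun ω : ℕ → Z × E × H => f (ω 0) := hf.comp (measurable_pi_apply 0)
  have h_traj : ∀ x₀ : Finset.Iic 0 → Z × E × H,
      ∫⁻ ω, f (ω 0) ∂Kernel.traj (X := fun _ => Z × E × H) M.historyKernel 0 x₀ =
        f (x₀ ⟨0, by simp⟩) := fun x₀ => by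
    rw [Kernel.lintegral_traj _ h_meas]
    simp [Function.updateFinset]
  have h_meas_init : Measurable fun x₀ : Finset.Iic 0 → Z × E × H => f (x₀ ⟨0, by simp⟩) :=
    hf.comp (measurable_pi_apply _)
  rw [pathLaw, Kernel.trajMeasure, Measure.lintegral_bind (Kernel.aemeasurable _)
    h_meas.aemeasurable]
  simp_rw [h_traj]
  rw [lintegral_map h_meas_init (MeasurableEquiv.measurable _)]
  change ∫⁻ x, f x ∂(Measure.dirac z).prod (M.ν.prod M.μ) = _
  rw [lintegral_prod _ hf.aemeasurable, lintegral_dirac' _ hf.lintegral_prod_right']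

lemma lintegral_pathLaw_zero_fst {g : Z → ℝ≥0∞} (hg : Measurable g) (z : Z) :
    ∫⁻ ω, g (ω 0).1 ∂M.pathLaw z = g z := by
  rw [lintegral_pathLaw_zero (f := fun x => g x.1) (hg.comp measurable_fst)]
  simp only [lintegral_const, measure_univ, mul_one]

lemma lintegral_pathLaw_frestrictLe_succ {t : ℕ}
    {f : (Finset.Iic t → Z × E × H) × (Z × E × H) → ℝ≥0∞} (hf : Measurable f) (z : Z) :
    ∫⁻ ω, f (Preorder.frestrictLe t ω, ω (t + 1)) ∂M.pathLaw z =
      ∫⁻ ω, ∫⁻ x, f (Preorder.frestrictLe t ω, x) ∂M.shockKernel (ω t).1 ∂M.pathLaw z := by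
  have h_restrict : Measurable
      (Preorder.frestrictLe t : (ℕ → Z × E × H) → (Finset.Iic t → Z × E × H)) := by fun_prop
  have : IsProbabilityMeasure ((M.pathLaw z).map
      (Preorder.frestrictLe (π := fun _ => Z × E × H) t)) :=
    Measure.isProbabilityMeasure_map h_restrict.aemeasurable
  have h_compProd : (M.pathLaw z).map (Preorder.frestrictLe t) ⊗ₘ M.historyKernel t =
      (M.pathLaw z).map fun ω => (Preorder.frestrictLe t ω, ω (t + 1)) :=
    Kernel.map_frestrictLe_trajMeasure_compProd_eq_map_trajMeasure (X := fun _ => Z × E × H)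
  rw [← lintegral_map hf (h_restrict.prodMk (measurable_pi_apply _)), ← h_compProd,
    Measure.lintegral_compProd hf, lintegral_map hf.lintegral_kernel_prod_right' h_restrict]
  rfl

theorem lintegral_pathLaw_succ {t : ℕ} {F : (ℕ → Z × E × H) → Z × E × H → ℝ≥0∞}
    (hF : Measurable (Function.uncurry F)) (hF_dep : DependsOn F (Iic t)) (z : Z) :
    ∫⁻ ω, F ω (ω (t + 1)) ∂M.pathLaw z =
      ∫⁻ ω, ∫⁻ x, F ω x ∂M.shockKernel (ω t).1 ∂M.pathLaw z := by
  let stopped : (Finset.Iic t → Z × E × H) → ℕ → Z × E × H :=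
    fun h i => h ⟨min i t, Finset.mem_Iic.2 (min_le_right _ _)⟩
  have h_stopped : Measurable stopped := measurable_pi_lambda _ fun i => measurable_pi_apply _
  have hF_stopped : ∀ ω, F (stopped (Preorder.frestrictLe t ω)) = F ω := fun ω =>
    hF_dep fun i hi => congrArg ω (min_eq_left hi)
  have h_markov := lintegral_pathLaw_frestrictLe_succ (M := M) (f := fun p => F (stopped p.1) p.2)
    (hF.comp ((h_stopped.comp measurable_fst).prodMk measurable_snd)) z
  simpa only [hF_stopped] using h_markov

lemma measurable_returnAt (t : ℕ) : Measurable fun ω => M.returnAt ω t :=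
  measurable_return.comp (measurable_pi_apply t)

lemma measurable_incomeAt (t : ℕ) : Measurable fun ω => M.incomeAt ω t :=
  measurable_income.comp (measurable_pi_apply t)

/-- `βᵗ E_z f`, the present value of a payoff `f` received at time `t`. -/
def discountedMean (M : IncomeFluctuation Z E H) (z : Z) (t : ℕ) (f : (ℕ → Z × E × H) → ℝ≥0∞) :
    ℝ≥0∞ :=
  M.β ^ t * ∫⁻ ω, f ω ∂M.pathLaw z

section DiscountedMean

variable {f g : (ℕ → Z × E × H) → ℝ≥0∞} (z : Z) (t : ℕ)

lemma discountedMean_mono (h : ∀ ω, f ω ≤ g ω) :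
    M.discountedMean z t f ≤ M.discountedMean z t g :=
  mul_le_mul_right (lintegral_mono h) _

lemma discountedMean_add (hf : Measurable f) :
    M.discountedMean z t (fun ω => f ω + g ω) =
      M.discountedMean z t f + M.discountedMean z t g := by
  rw [discountedMean, lintegral_add_left hf, mul_add]
  rfl

lemma discountedMean_const_mul (r : ℝ≥0∞) (hf : Measurable f) :
    M.discountedMean z t (fun ω => r * f ω) = r * M.discountedMean z t f := by
  rw [discountedMean, lintegral_const_mul r hf, mul_left_comm]
  rfl

lemma discountedMean_const (r : ℝ≥0∞) : M.discountedMean z t (fun _ => r) = M.β ^ t * r := by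
  rw [discountedMean, lintegral_const, measure_univ, mul_one]

lemma discountedMean_zero {g : Z → ℝ≥0∞} (hg : Measurable g) :
    M.discountedMean z 0 (fun ω => g (ω 0).1) = g z := by
  rw [discountedMean, lintegral_pathLaw_zero_fst hg, pow_zero, one_mul]

variable {t}

lemma discountedMean_succ {F : (ℕ → Z × E × H) → Z × E × H → ℝ≥0∞}
    (hF : Measurable (Function.uncurry F)) (hF_dep : DependsOn F (Iic t)) :
    M.discountedMean z (t + 1) (fun ω => F ω (ω (t + 1))) =
      M.discountedMean z t fun ω => M.β * ∫⁻ x, F ω x ∂M.shockKernel (ω t).1 := by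
  rw [discountedMean, discountedMean, lintegral_pathLaw_succ hF hF_dep,
    lintegral_const_mul' _ _ ENNReal.coe_ne_top, pow_succ, mul_assoc]

lemma tsum_discountedMean_const_ne_top {r : ℝ≥0∞} (hr : r ≠ ⊤) :
    ∑' t, M.discountedMean z t (fun _ => r) ≠ ⊤ := by
  simp_rw [discountedMean_const]
  rw [ENNReal.tsum_mul_right, ENNReal.tsum_geometric]
  refine ENNReal.mul_ne_top (ENNReal.inv_ne_top.2 (tsub_pos_of_lt ?_).ne') hr
  exact_mod_cast M.β_lt_one

lemma tsum_discountedMean_ne_top_of_le {f g h : ℕ → (ℕ → Z × E × H) → ℝ≥0∞} {r : ℝ≥0∞}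
    (hfgh : ∀ t ω, f t ω ≤ g t ω + r * h t ω) (hh : ∀ t, Measurable (h t)) (hr : r ≠ ⊤)
    (hg_top : ∑' t, M.discountedMean z t (g t) ≠ ⊤)
    (hh_top : ∑' t, M.discountedMean z t (h t) ≠ ⊤) :
    ∑' t, M.discountedMean z t (f t) ≠ ⊤ := by
  have h_le : ∀ t, M.discountedMean z t (f t) ≤
      M.discountedMean z t (g t) + r * M.discountedMean z t (h t) := fun t => by
    refine (discountedMean_mono z t (hfgh t)).trans_eq ?_
    simp_rw [discountedMean, lintegral_add_right _ ((hh t).const_mul r),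
      lintegral_const_mul r (hh t)]
    ring
  refine ne_top_of_le_ne_top ?_ (ENNReal.tsum_le_tsum h_le)
  rw [ENNReal.tsum_add, ENNReal.tsum_mul_left]
  exact ENNReal.add_ne_top.2 ⟨hg_top, ENNReal.mul_ne_top hr hh_top⟩

end DiscountedMean

/-! ### Compound returns -/

lemma lintegral_prod_returnAt_mul (n : ℕ) {γ : Z → ℝ≥0∞} (hγ : Measurable γ) (z : Z) :
    ∫⁻ ω, (∏ t ∈ Finset.Icc 1 n, (M.returnAt ω t : ℝ≥0∞)) * γ (ω n).1 ∂M.pathLaw z =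
      (M.returnOp^[n] γ) z := by
  induction n generalizing γ with
  | zero => simpa using lintegral_pathLaw_zero_fst hγ z
  | succ n ih =>
    have h_prod : Measurable fun ω => ∏ t ∈ Finset.Icc 1 n, (M.returnAt ω t : ℝ≥0∞) :=
      Finset.measurable_fun_prod _ fun t _ => (measurable_returnAt t).coe_nnreal_ennreal
    have h_markov := lintegral_pathLaw_succ (M := M) (t := n)
      (F := fun ω x => (∏ t ∈ Finset.Icc 1 n, (M.returnAt ω t : ℝ≥0∞)) *
        (M.R (x.1, x.2.1) * γ x.1))
      ((h_prod.comp measurable_fst).mul ((measurable_return_mul hγ).comp measurable_snd))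
      (fun ω ω' h => funext fun x => congrArg (· * _) (Finset.prod_congr rfl fun t ht => by
        rw [returnAt, returnAt, h t (Finset.mem_Icc.1 ht).2])) z
    simp_rw [lintegral_const_mul _ (measurable_return_mul hγ)] at h_markov
    rw [Function.iterate_succ_apply, ← ih (measurable_returnOp hγ)]
    refine Eq.trans (lintegral_congr fun ω => ?_) h_markov
    rw [Finset.prod_Icc_succ_top (Nat.le_add_left 1 n), mul_assoc]
    rfl

/-- `sup_z E_z R_1 ⋯ R_k`. -/
def supReturn (M : IncomeFluctuation Z E H) (k : ℕ) : ℝ≥0∞ := ⨆ z, (M.returnOp^[k] fun _ => 1) z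

lemma returnOp_iterate_one_le_supReturn (k : ℕ) (z : Z) :
    (M.returnOp^[k] fun _ => 1) z ≤ M.supReturn k :=
  le_iSup (M.returnOp^[k] fun _ => 1) z

lemma theta_eq_pow_mul_supReturn (n : ℕ) : M.theta n = M.β ^ n * M.supReturn n := by
  simp only [theta, supReturn, ← lintegral_prod_returnAt_mul n measurable_const, mul_one]

lemma supReturn_add_le (j k : ℕ) : M.supReturn (j + k) ≤ M.supReturn j * M.supReturn k := by
  refine iSup_le fun z => ?_
  have h_le : (M.returnOp^[j] fun _ => 1) ≤ fun _ => M.supReturn j * 1 := fun y =>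
    (returnOp_iterate_one_le_supReturn j y).trans_eq (mul_one _).symm
  rw [add_comm, Function.iterate_add_apply]
  refine (monotone_returnOp.iterate k h_le z).trans ?_
  rw [returnOp_iterate_const_mul _ measurable_const]
  exact mul_le_mul_right (returnOp_iterate_one_le_supReturn k z) _

lemma MomentAssumption.supReturn_ne_top (hmom : M.MomentAssumption) (k : ℕ) :
    M.supReturn k ≠ ⊤ := by
  induction k with
  | zero => exact ne_top_of_le_ne_top ENNReal.one_ne_top (iSup_le fun _ => le_rfl)
  | succ k ih =>
    have h_one : M.supReturn 1 = ⨆ z, M.meanReturn z := by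
      rw [supReturn, Function.iterate_one, returnOp_one]
    refine ne_top_of_le_ne_top (ENNReal.mul_ne_top ih ?_) (supReturn_add_le k 1)
    exact h_one ▸ hmom.mean_return.ne

lemma MomentAssumption.tsum_pow_mul_supReturn_ne_top (hmom : M.MomentAssumption) {n : ℕ}
    (hθ : M.theta n < 1) : ∑' k, M.β ^ k * M.supReturn k ≠ ⊤ := by
  refine tsum_ne_top_of_add_le_mul
    (fun k => ENNReal.mul_ne_top (ENNReal.pow_ne_top ENNReal.coe_ne_top)
      (hmom.supReturn_ne_top k)) hθ (n := n) fun k => ?_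
  rw [theta_eq_pow_mul_supReturn, pow_add, mul_mul_mul_comm]
  exact mul_le_mul_right (supReturn_add_le n k) _

/-- `∑ₖ βᵏ E_z R_1 ⋯ R_k`, the total discounted future assets generated by one unit saved forever
in the exogenous state `z`. -/
def totalReturn (M : IncomeFluctuation Z E H) (z : Z) : ℝ≥0∞ :=
  ∑' k, M.β ^ k * (M.returnOp^[k] fun _ => 1) z

lemma totalReturn_le_tsum_supReturn (z : Z) :
    M.totalReturn z ≤ ∑' k, M.β ^ k * M.supReturn k :=
  ENNReal.tsum_le_tsum fun k => mul_le_mul_right (returnOp_iterate_one_le_supReturn k z) _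

lemma measurable_totalReturn : Measurable M.totalReturn :=
  Measurable.tsum fun k => (measurable_returnOp_iterate measurable_const k).const_mul _

lemma returnOp_totalReturn (z : Z) :
    M.returnOp M.totalReturn z = ∑' k, M.β ^ k * (M.returnOp^[k + 1] fun _ => 1) z := by
  have h_meas : ∀ k, Measurable (M.returnOp^[k] fun _ => 1) :=
    measurable_returnOp_iterate measurable_const
  simp_rw [returnOp, totalReturn, ← ENNReal.tsum_mul_left]
  rw [lintegral_tsum fun k => (measurable_return_mul ((h_meas k).const_mul _)).aemeasurable]
  refine tsum_congr fun k => ?_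
  rw [Function.iterate_succ_apply']
  exact congrFun (returnOp_const_mul _ (h_meas k)) z

lemma totalReturn_eq (z : Z) : M.totalReturn z = 1 + M.β * M.returnOp M.totalReturn z := by
  rw [returnOp_totalReturn, totalReturn, tsum_eq_zero_add' ENNReal.summable,
    ← ENNReal.tsum_mul_left]
  simp only [pow_zero, Function.iterate_zero, id_eq, one_mul, pow_succ', mul_assoc]

/-! ### Consumption and savings along asset paths -/

/-- Consumption `c_t = c(a_t, z_t)` along the asset path of the policy `c`. -/
def consumption (M : IncomeFluctuation Z E H) (c : State Z → ℝ) (a : ℝ) (ω : ℕ → Z × E × H)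
    (t : ℕ) : ℝ :=
  extend c (M.assetPath c a ω t) (ω t).1

/-- Savings `a_t - c_t` along the asset path of the policy `c`. -/
def savings (M : IncomeFluctuation Z E H) (c : State Z → ℝ) (a : ℝ) (ω : ℕ → Z × E × H)
    (t : ℕ) : ℝ :=
  M.assetPath c a ω t - M.consumption c a ω t

lemma assetPath_succ (c : State Z → ℝ) (a : ℝ) (ω : ℕ → Z × E × H) (t : ℕ) :
    M.assetPath c a ω (t + 1) =
      M.returnAt ω (t + 1) * M.savings c a ω t + M.incomeAt ω (t + 1) := rfl

lemma dependsOn_assetPath (c : State Z → ℝ) (a : ℝ) (t : ℕ) :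
    DependsOn (fun ω => M.assetPath c a ω t) (Iic t) := by
  intro ω ω' h
  induction t with
  | zero => rfl
  | succ t ih =>
    have h_prev := ih fun i hi => h i (mem_Iic.2 (le_trans hi t.le_succ))
    simp only [assetPath, returnAt, incomeAt, h (t + 1) self_mem_Iic,
      h t (mem_Iic.2 t.le_succ), h_prev]

lemma dependsOn_savings (c : State Z → ℝ) (a : ℝ) (t : ℕ) :
    DependsOn (fun ω => M.savings c a ω t) (Iic t) := fun ω ω' h => by
  simp only [savings, consumption, dependsOn_assetPath c a t h, h t self_mem_Iic]

namespace IsFeasible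

variable {c : State Z → ℝ} (hc : IsFeasible c) {a : ℝ} (ha : 0 ≤ a)
include hc

lemma consumption_nonneg (a : ℝ) (ω : ℕ → Z × E × H) (t : ℕ) : 0 ≤ M.consumption c a ω t :=
  extend_nonneg (fun s => (hc.2 s).1) _ _

lemma measurable_assetPath (a : ℝ) (t : ℕ) : Measurable fun ω => M.assetPath c a ω t := by
  induction t with
  | zero => exact measurable_const
  | succ t ih =>
    have h_consumption : Measurable fun ω => M.consumption c a ω t :=
      (measurable_extend hc.1).comp (ih.prodMk (measurable_fst.comp (measurable_pi_apply t)))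
    exact ((measurable_returnAt (t + 1)).coe_nnreal_real.mul (ih.sub h_consumption)).add
      (measurable_incomeAt (t + 1)).coe_nnreal_real

lemma measurable_consumption (a : ℝ) (t : ℕ) : Measurable fun ω => M.consumption c a ω t :=
  (measurable_extend hc.1).comp ((hc.measurable_assetPath a t).prodMk
    (measurable_fst.comp (measurable_pi_apply t)))

lemma measurable_savings (a : ℝ) (t : ℕ) : Measurable fun ω => M.savings c a ω t :=
  (hc.measurable_assetPath a t).sub (hc.measurable_consumption a t)

include ha

lemma assetPath_nonneg_and_savings_nonneg (ω : ℕ → Z × E × H) (t : ℕ) :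
    0 ≤ M.assetPath c a ω t ∧ 0 ≤ M.savings c a ω t := by
  have h_savings : ∀ t, 0 ≤ M.assetPath c a ω t → 0 ≤ M.savings c a ω t := fun t h =>
    sub_nonneg.2 ((extend_le_max (fun s => (hc.2 s).2) _ _).trans_eq (max_eq_left h))
  induction t with
  | zero => exact ⟨ha, h_savings 0 ha⟩
  | succ t ih =>
    have h_assets : 0 ≤ M.assetPath c a ω (t + 1) := by
      rw [assetPath_succ]
      exact add_nonneg (mul_nonneg NNReal.zero_le_coe ih.2) NNReal.zero_le_coe
    exact ⟨h_assets, h_savings _ h_assets⟩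

lemma assetPath_nonneg (ω : ℕ → Z × E × H) (t : ℕ) : 0 ≤ M.assetPath c a ω t :=
  (hc.assetPath_nonneg_and_savings_nonneg ha ω t).1

lemma savings_nonneg (ω : ℕ → Z × E × H) (t : ℕ) : 0 ≤ M.savings c a ω t :=
  (hc.assetPath_nonneg_and_savings_nonneg ha ω t).2

lemma ofReal_consumption_add_savings (ω : ℕ → Z × E × H) (t : ℕ) :
    ENNReal.ofReal (M.consumption c a ω t) + ENNReal.ofReal (M.savings c a ω t) =
      ENNReal.ofReal (M.assetPath c a ω t) := by
  rw [← ENNReal.ofReal_add (hc.consumption_nonneg a ω t) (hc.savings_nonneg ha ω t), savings,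
    add_sub_cancel]

lemma ofReal_assetPath_succ (ω : ℕ → Z × E × H) (t : ℕ) :
    ENNReal.ofReal (M.assetPath c a ω (t + 1)) =
      M.returnAt ω (t + 1) * ENNReal.ofReal (M.savings c a ω t) + M.incomeAt ω (t + 1) := by
  rw [assetPath_succ, ENNReal.ofReal_add
      (mul_nonneg NNReal.zero_le_coe (hc.savings_nonneg ha ω t)) NNReal.zero_le_coe,
    ENNReal.ofReal_mul NNReal.zero_le_coe, ENNReal.ofReal_coe_nnreal, ENNReal.ofReal_coe_nnreal]

lemma ofReal_assetPath_succ_mul_totalReturn_le (ω : ℕ → Z × E × H) (t : ℕ) :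
    ENNReal.ofReal (M.assetPath c a ω (t + 1)) * M.totalReturn (ω (t + 1)).1 ≤
      ENNReal.ofReal (M.assetPath c a ω t) *
          (M.returnAt ω (t + 1) * M.totalReturn (ω (t + 1)).1) +
        (∑' k, M.β ^ k * M.supReturn k) * M.incomeAt ω (t + 1) := by
  rw [hc.ofReal_assetPath_succ ha, add_mul, mul_right_comm, mul_comm _ (ENNReal.ofReal _),
    mul_comm (M.incomeAt ω (t + 1) : ℝ≥0∞), ← hc.ofReal_consumption_add_savings ha ω t]
  gcongr
  · exact le_add_self
  · exact totalReturn_le_tsum_supReturn _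

lemma discountedMean_assetPath_mul_totalReturn_succ_le (z : Z) (t : ℕ) :
    M.discountedMean z (t + 1)
        (fun ω => ENNReal.ofReal (M.assetPath c a ω (t + 1)) * M.totalReturn (ω (t + 1)).1) ≤
      M.discountedMean z t (fun ω => ENNReal.ofReal (M.assetPath c a ω t) *
          (M.β * M.returnOp M.totalReturn (ω t).1)) +
        (∑' k, M.β ^ k * M.supReturn k) *
          M.discountedMean z (t + 1) fun ω => M.incomeAt ω (t + 1) := by
  have h_return : Measurable fun x : Z × E × H =>
      (M.R (x.1, x.2.1) : ℝ≥0∞) * M.totalReturn x.1 := measurable_return_mul measurable_totalReturn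
  have h_assets := (hc.measurable_assetPath (M := M) a t).ennreal_ofReal
  have h_markov := discountedMean_succ (M := M) z (t := t)
    (F := fun ω x => ENNReal.ofReal (M.assetPath c a ω t) *
      (M.R (x.1, x.2.1) * M.totalReturn x.1))
    ((h_assets.comp measurable_fst).mul (h_return.comp measurable_snd))
    fun ω ω' h => by simp only [dependsOn_assetPath c a t h]
  simp only [lintegral_const_mul _ h_return, mul_left_comm (M.β : ℝ≥0∞)] at h_markov
  have h_meas : Measurable fun ω => ENNReal.ofReal (M.assetPath c a ω t) *
      (M.returnAt ω (t + 1) * M.totalReturn (ω (t + 1)).1) :=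
    h_assets.mul (h_return.comp (measurable_pi_apply (t + 1)))
  refine (discountedMean_mono z _
    (hc.ofReal_assetPath_succ_mul_totalReturn_le ha · t)).trans_eq ?_
  rw [discountedMean_add z _ h_meas,
    discountedMean_const_mul z _ _ (measurable_incomeAt _).coe_nnreal_ennreal]
  exact congrArg (· + _) h_markov

/-- Weighting assets by `totalReturn` makes their discounted mean drop by the discounted mean of
assets in each period, up to a multiple of mean income. -/
theorem tsum_assetPath_ne_top (hmom : M.MomentAssumption) {n : ℕ} (hθ : M.theta n < 1)
    (hY : M.IncomeAssumption) (z : Z) :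
    ∑' t, M.discountedMean z t (fun ω => ENNReal.ofReal (M.assetPath c a ω t)) ≠ ⊤ := by
  let weighted (t : ℕ) : ℝ≥0∞ := M.discountedMean z t
    fun ω => ENNReal.ofReal (M.assetPath c a ω t) * M.totalReturn (ω t).1
  have hS : ∑' k, M.β ^ k * M.supReturn k ≠ ⊤ := hmom.tsum_pow_mul_supReturn_ne_top hθ
  have h_drop : ∀ t, M.discountedMean z t (fun ω => ENNReal.ofReal (M.assetPath c a ω t)) +
      weighted (t + 1) ≤ weighted t +
        (∑' k, M.β ^ k * M.supReturn k) *
          M.discountedMean z (t + 1) fun ω => M.incomeAt ω (t + 1) := fun t => by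
    have h_weighted : weighted t =
        M.discountedMean z t (fun ω => ENNReal.ofReal (M.assetPath c a ω t)) +
        M.discountedMean z t (fun ω => ENNReal.ofReal (M.assetPath c a ω t) *
          (M.β * M.returnOp M.totalReturn (ω t).1)) := by
      rw [← discountedMean_add z t (hc.measurable_assetPath a t).ennreal_ofReal]
      exact congrArg (M.discountedMean z t)
        (funext fun ω => by rw [totalReturn_eq, mul_add, mul_one])
    rw [h_weighted, add_assoc]
    exact add_le_add_right (hc.discountedMean_assetPath_mul_totalReturn_succ_le ha z t) _
  have h_zero : weighted 0 = ENNReal.ofReal a * M.totalReturn z :=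
    discountedMean_zero (g := fun z => ENNReal.ofReal a * M.totalReturn z) z
      (measurable_totalReturn.const_mul _)
  refine ne_top_of_le_ne_top ?_ (tsum_le_add_tsum_of_add_le_add h_drop)
  rw [h_zero, ENNReal.tsum_mul_left]
  exact ENNReal.add_ne_top.2 ⟨ENNReal.mul_ne_top ENNReal.ofReal_ne_top
    (ne_top_of_le_ne_top hS (totalReturn_le_tsum_supReturn z)), ENNReal.mul_ne_top hS (hY z).ne⟩

end IsFeasible

/-! ### Lifetime utility -/

/-- `E_{a,z} ∑ₜ βᵗ u⁺(cₜ)`, the positive part of the lifetime value. -/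
def utilityPos (M : IncomeFluctuation Z E H) (c : State Z → ℝ) (a : ℝ) (z : Z) : ℝ≥0∞ :=
  ∑' t, M.discountedMean z t fun ω => M.posUtility (M.consumption c a ω t)

/-- `E_{a,z} ∑ₜ βᵗ u⁻(cₜ)`, the negative part of the lifetime value. -/
def utilityNeg (M : IncomeFluctuation Z E H) (c : State Z → ℝ) (a : ℝ) (z : Z) : ℝ≥0∞ :=
  ∑' t, M.discountedMean z t fun ω => M.negUtility (M.consumption c a ω t)

lemma lintegral_tsum_pow_mul {f : ℕ → (ℕ → Z × E × H) → ℝ≥0∞} (hf : ∀ t, Measurable (f t))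
    (z : Z) :
    ∫⁻ ω, ∑' t, M.β ^ t * f t ω ∂M.pathLaw z = ∑' t, M.discountedMean z t (f t) := by
  rw [lintegral_tsum fun t => ((hf t).const_mul _).aemeasurable]
  exact tsum_congr fun t => lintegral_const_mul _ (hf t)

lemma InadaUtility.measurable_posUtility (hu : M.InadaUtility) : Measurable M.posUtility :=
  (hu.monotone_utility.measurable.comp measurable_real_toNNReal).ereal_toENNReal

lemma InadaUtility.measurable_negUtility (hu : M.InadaUtility) : Measurable M.negUtility :=
  (hu.monotone_utility.measurable.comp measurable_real_toNNReal).neg.ereal_toENNReal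

namespace IsFeasible

variable {c : State Z → ℝ} (hc : IsFeasible c) (hu : M.InadaUtility) {a : ℝ}
include hc hu

lemma lifetimeValue_eq (s : State Z) :
    M.lifetimeValue c s = (M.utilityPos c s.1 s.2 : EReal) - M.utilityNeg c s.1 s.2 := by
  have h_consumption : ∀ t, Measurable fun ω => M.consumption c s.1 ω t :=
    hc.measurable_consumption s.1
  have h_pos := lintegral_tsum_pow_mul (M := M)
    (fun t => hu.measurable_posUtility.comp (h_consumption t)) s.2
  have h_neg := lintegral_tsum_pow_mul (M := M)
    (fun t => hu.measurable_negUtility.comp (h_consumption t)) s.2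
  exact congrArg₂ (fun p q : ℝ≥0∞ => (p : EReal) - q) h_pos h_neg

lemma lintegral_marginalE_assetPath_le (ha : 0 ≤ a) (z : Z) (t : ℕ) :
    ∫⁻ ω, M.marginalE (M.assetPath c a ω t) ∂M.pathLaw z ≤
      M.marginalE a + ⨆ z, M.meanMarginalIncome z := by
  cases t with
  | zero =>
    simp only [assetPath, lintegral_const, measure_univ, mul_one]
    exact le_self_add
  | succ t =>
    have h_income : ∀ ω, (M.incomeAt ω (t + 1) : ℝ) ≤ M.assetPath c a ω (t + 1) := fun ω => by
      rw [assetPath_succ]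
      exact le_add_of_nonneg_left (mul_nonneg NNReal.zero_le_coe (hc.savings_nonneg ha ω t))
    calc ∫⁻ ω, M.marginalE (M.assetPath c a ω (t + 1)) ∂M.pathLaw z
        ≤ ∫⁻ ω, M.marginalE (M.incomeAt ω (t + 1)) ∂M.pathLaw z :=
          lintegral_mono fun ω => hu.antitone_marginalE (h_income ω)
      _ = ∫⁻ ω, M.meanMarginalIncome (ω t).1 ∂M.pathLaw z :=
          lintegral_pathLaw_succ (F := fun _ x => M.marginalE (M.Y (x.1, x.2.2)))
            (hu.measurable_marginalE_income.comp measurable_snd) (fun _ _ _ => rfl) z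
      _ ≤ ∫⁻ _, ⨆ z, M.meanMarginalIncome z ∂M.pathLaw z :=
          lintegral_mono fun ω => le_iSup M.meanMarginalIncome _
      _ = ⨆ z, M.meanMarginalIncome z := by rw [lintegral_const, measure_univ, mul_one]
      _ ≤ M.marginalE a + ⨆ z, M.meanMarginalIncome z := le_add_self

lemma tsum_marginalE_assetPath_ne_top (hmom : M.MomentAssumption) (ha : 0 < a) (z : Z) :
    ∑' t, M.discountedMean z t (fun ω => M.marginalE (M.assetPath c a ω t)) ≠ ⊤ := by
  have h_bound : M.marginalE a + ⨆ z, M.meanMarginalIncome z ≠ ⊤ :=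
    ENNReal.add_ne_top.2 ⟨marginalE_ne_top ha, hmom.mean_marginal.ne⟩
  refine ne_top_of_le_ne_top (tsum_discountedMean_const_ne_top (M := M) z h_bound)
    (ENNReal.tsum_le_tsum fun t => ?_)
  rw [discountedMean_const]
  exact mul_le_mul_right (hc.lintegral_marginalE_assetPath_le hu ha.le z t) _

lemma utilityPos_ne_top (hmom : M.MomentAssumption) {n : ℕ} (hθ : M.theta n < 1)
    (hY : M.IncomeAssumption) (ha : 0 ≤ a) (z : Z) : M.utilityPos c a z ≠ ⊤ := by
  refine tsum_discountedMean_ne_top_of_le z (g := fun _ _ => M.posUtility 1) (fun t ω => ?_)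
    (fun t => (hc.measurable_assetPath a t).ennreal_ofReal) (marginalE_ne_top (M := M) one_pos)
    (tsum_discountedMean_const_ne_top z (M.posUtility_ne_top 1))
    (hc.tsum_assetPath_ne_top ha hmom hθ hY z)
  refine (hu.posUtility_le (hc.consumption_nonneg a ω t)).trans ?_
  rw [← hc.ofReal_consumption_add_savings ha ω t]
  gcongr
  exact le_self_add

end IsFeasible

lemma Candidate.utilityNeg_ne_top [OpensMeasurableSpace (State Z)] (c : M.Candidate)
    (hu : M.InadaUtility) (hmom : M.MomentAssumption) {a : ℝ} (ha : 0 < a) (z : Z) :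
    M.utilityNeg c.toFun a z ≠ ⊤ := by
  obtain ⟨K, hK⟩ := exists_marginalE_extend_le hu c
  refine tsum_discountedMean_ne_top_of_le z (g := fun _ _ => M.negUtility 1 + K) (r := 1)
    (fun t ω => ?_)
    (fun t => hu.measurable_marginalE.comp (c.isFeasible.measurable_assetPath a t))
    ENNReal.one_ne_top
    (tsum_discountedMean_const_ne_top z
      (ENNReal.add_ne_top.2 ⟨hu.negUtility_ne_top one_pos, ENNReal.coe_ne_top⟩))
    (c.isFeasible.tsum_marginalE_assetPath_ne_top hu hmom ha z)
  calc M.negUtility (M.consumption c.toFun a ω t)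
      ≤ M.negUtility 1 + M.marginalE (M.consumption c.toFun a ω t) := hu.negUtility_le _
    _ ≤ M.negUtility 1 + (M.marginalE (M.assetPath c.toFun a ω t) + K) :=
        add_le_add_right (hK _ _) _
    _ = M.negUtility 1 + K + 1 * M.marginalE (M.assetPath c.toFun a ω t) := by ring

/-! ### The Euler equation -/

/-- The Euler equation `u'(c) = max {β E_z R̂ (u' ∘ c)(R̂ (a - c) + Ŷ, ẑ), u'(a)}`, which
characterizes the fixed points of the Coleman operator. -/
def Candidate.IsEuler (c : M.Candidate) : Prop :=
  ∀ s, M.marginalE (c.toFun s) = M.psi c.toFun (c.toFun s) s.1 s.2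

namespace Candidate.IsEuler

variable {c : M.Candidate} (hE : c.IsEuler)
include hE

lemma eulerMean_le (a : ℝ) (z : Z) :
    M.β * M.eulerMean c.toFun (a - extend c.toFun a z) z ≤ M.marginalE (extend c.toFun a z) := by
  rcases le_or_gt a 0 with ha | ha
  · rw [extend_of_nonpos ha, marginalE_of_nonpos le_rfl]
    exact le_top
  · rw [extend_of_pos ha, hE]
    exact le_max_left _ _

lemma savings_mul_eulerMean (hu : M.InadaUtility) (a : ℝ) (z : Z) :
    ENNReal.ofReal (a - extend c.toFun a z) *
        (M.β * M.eulerMean c.toFun (a - extend c.toFun a z) z) =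
      ENNReal.ofReal (a - extend c.toFun a z) * M.marginalE (extend c.toFun a z) := by
  rcases le_or_gt a (extend c.toFun a z) with h_all | h_lt
  · rw [ENNReal.ofReal_of_nonpos (sub_nonpos.2 h_all), zero_mul, zero_mul]
  have ha : 0 < a := (extend_nonneg (fun s => (c.pos s).le) a z).trans_lt h_lt
  rw [extend_of_pos ha] at h_lt ⊢
  have h_marginal : M.marginalE a < M.psi c.toFun (c.toFun (⟨a, ha⟩, z)) a z :=
    (hu.marginalE_lt_marginalE h_lt ha).trans_eq (hE (⟨a, ha⟩, z))
  have h_euler : M.marginalE (c.toFun (⟨a, ha⟩, z)) =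
      M.β * M.eulerMean c.toFun (a - c.toFun (⟨a, ha⟩, z)) z :=
    (hE (⟨a, ha⟩, z)).trans
      (max_eq_left ((lt_max_iff.1 h_marginal).resolve_right (lt_irrefl _)).le)
  rw [h_euler]

end Candidate.IsEuler

/-! ### Optimality of solutions of the Euler equation -/

/-- `βᵗ E_{a,z} u'(c_t) f`, the value of a payoff `f` received at time `t` at the state prices
`βᵗ u'(c_t)` generated by the consumption path of `c`. -/
def presentValue (M : IncomeFluctuation Z E H) (c : State Z → ℝ) (a : ℝ) (z : Z) (t : ℕ)
    (f : (ℕ → Z × E × H) → ℝ≥0∞) : ℝ≥0∞ :=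
  M.discountedMean z t fun ω => M.marginalE (M.consumption c a ω t) * f ω

section PresentValue

variable (hu : M.InadaUtility) {c d : State Z → ℝ} (hc : IsFeasible c) (hd : IsFeasible d)
  {a : ℝ}
include hu hc

lemma presentValue_add {f g : (ℕ → Z × E × H) → ℝ≥0∞} (hf : Measurable f) (z : Z) (t : ℕ) :
    M.presentValue c a z t (fun ω => f ω + g ω) =
      M.presentValue c a z t f + M.presentValue c a z t g := by
  have h_meas : Measurable fun ω => M.marginalE (M.consumption c a ω t) * f ω :=
    (hu.measurable_marginalE.comp (hc.measurable_consumption a t)).mul hf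
  simp only [presentValue, mul_add]
  exact discountedMean_add z t h_meas

include hd

lemma presentValue_assetPath (ha : 0 ≤ a) (z : Z) (t : ℕ) :
    M.presentValue c a z t (fun ω => ENNReal.ofReal (M.assetPath d a ω t)) =
      M.presentValue c a z t (fun ω => ENNReal.ofReal (M.consumption d a ω t)) +
        M.presentValue c a z t fun ω => ENNReal.ofReal (M.savings d a ω t) := by
  rw [← presentValue_add hu hc (hd.measurable_consumption a t).ennreal_ofReal]
  simp only [hd.ofReal_consumption_add_savings ha]

lemma presentValue_returnAt_mul_savings (z : Z) (t : ℕ) :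
    M.presentValue c a z (t + 1)
        (fun ω => M.returnAt ω (t + 1) * ENNReal.ofReal (M.savings d a ω t)) =
      M.discountedMean z t fun ω => ENNReal.ofReal (M.savings d a ω t) *
        (M.β * M.eulerMean c (M.savings c a ω t) (ω t).1) := by
  let F (ω : ℕ → Z × E × H) (x : Z × E × H) : ℝ≥0∞ := ENNReal.ofReal (M.savings d a ω t) *
    (M.R (x.1, x.2.1) *
      M.marginalE (extend c (M.R (x.1, x.2.1) * M.savings c a ω t + M.Y (x.1, x.2.2)) x.1))
  have h_next : Measurable fun p : (ℕ → Z × E × H) × (Z × E × H) =>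
      (M.R (p.2.1, p.2.2.1) * M.savings c a p.1 t + M.Y (p.2.1, p.2.2.2) : ℝ) :=
    ((measurable_return.comp measurable_snd).coe_nnreal_real.mul
      ((hc.measurable_savings a t).comp measurable_fst)).add
      (measurable_income.comp measurable_snd).coe_nnreal_real
  have hF : Measurable (Function.uncurry F) :=
    ((hd.measurable_savings a t).comp measurable_fst).ennreal_ofReal.mul
      ((measurable_return.comp measurable_snd).coe_nnreal_ennreal.mul
        (hu.measurable_marginalE.comp
          ((measurable_extend hc.1).comp (h_next.prodMk (measurable_fst.comp measurable_snd)))))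
  have hF_dep : DependsOn F (Iic t) := fun ω ω' h => by
    simp only [F, dependsOn_savings d a t h, dependsOn_savings c a t h]
  calc M.presentValue c a z (t + 1)
        (fun ω => M.returnAt ω (t + 1) * ENNReal.ofReal (M.savings d a ω t))
      = M.discountedMean z (t + 1) fun ω => F ω (ω (t + 1)) :=
        congrArg (M.discountedMean z (t + 1)) (funext fun ω => by
          beta_reduce
          rw [mul_comm (M.returnAt ω (t + 1) : ℝ≥0∞), mul_left_comm, mul_comm (M.marginalE _)]
          rfl)
    _ = M.discountedMean z t fun ω => M.β * ∫⁻ x, F ω x ∂M.shockKernel (ω t).1 :=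
        discountedMean_succ z hF hF_dep
    _ = M.discountedMean z t fun ω => ENNReal.ofReal (M.savings d a ω t) *
          (M.β * M.eulerMean c (M.savings c a ω t) (ω t).1) :=
        congrArg (M.discountedMean z t) (funext fun ω => by
          rw [lintegral_const_mul' _ _ ENNReal.ofReal_ne_top, mul_left_comm]
          rfl)

lemma presentValue_assetPath_succ (ha : 0 ≤ a) (z : Z) (t : ℕ) :
    M.presentValue c a z (t + 1) (fun ω => ENNReal.ofReal (M.assetPath d a ω (t + 1))) =
      M.discountedMean z t (fun ω => ENNReal.ofReal (M.savings d a ω t) *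
        (M.β * M.eulerMean c (M.savings c a ω t) (ω t).1)) +
      M.presentValue c a z (t + 1) fun ω => M.incomeAt ω (t + 1) := by
  have h_return : Measurable fun ω =>
      M.returnAt ω (t + 1) * ENNReal.ofReal (M.savings d a ω t) :=
    (measurable_returnAt (t + 1)).coe_nnreal_ennreal.mul
      (hd.measurable_savings a t).ennreal_ofReal
  simp only [hd.ofReal_assetPath_succ ha]
  rw [presentValue_add hu hc h_return, presentValue_returnAt_mul_savings hu hc hd]

end PresentValue

lemma Candidate.tsum_presentValue_assetPath_ne_top [OpensMeasurableSpace (State Z)]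
    (c : M.Candidate) (hu : M.InadaUtility) (hmom : M.MomentAssumption) {n : ℕ}
    (hθ : M.theta n < 1) (hY : M.IncomeAssumption) {a : ℝ} (ha : 0 < a) (z : Z) :
    ∑' t, M.presentValue c.toFun a z t
      (fun ω => ENNReal.ofReal (M.assetPath c.toFun a ω t)) ≠ ⊤ := by
  have hc := c.isFeasible
  obtain ⟨K, hK⟩ := exists_marginalE_extend_le hu c
  refine tsum_discountedMean_ne_top_of_le z (r := M.marginalE 1 + K) (fun t ω => ?_)
    (fun t => (hc.measurable_assetPath a t).ennreal_ofReal)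
    (ENNReal.add_ne_top.2 ⟨marginalE_ne_top one_pos, ENNReal.coe_ne_top⟩)
    (hc.tsum_marginalE_assetPath_ne_top hu hmom ha z)
    (hc.tsum_assetPath_ne_top ha.le hmom hθ hY z)
  have h_tangent := hu.marginalE_mul_le (M.assetPath c.toFun a ω t).toNNReal
  rw [Real.coe_toNNReal _ (hc.assetPath_nonneg ha.le ω t)] at h_tangent
  calc M.marginalE (M.consumption c.toFun a ω t) * ENNReal.ofReal (M.assetPath c.toFun a ω t)
      ≤ (M.marginalE (M.assetPath c.toFun a ω t) + K) *
          ENNReal.ofReal (M.assetPath c.toFun a ω t) := mul_le_mul_left (hK _ _) _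
    _ ≤ M.marginalE (M.assetPath c.toFun a ω t) +
          M.marginalE 1 * ENNReal.ofReal (M.assetPath c.toFun a ω t) +
          K * ENNReal.ofReal (M.assetPath c.toFun a ω t) := by
        rw [add_mul]
        exact add_le_add_left h_tangent _
    _ = M.marginalE (M.assetPath c.toFun a ω t) +
          (M.marginalE 1 + K) * ENNReal.ofReal (M.assetPath c.toFun a ω t) := by
        rw [add_mul, add_assoc]

lemma Candidate.tsum_presentValue_consumption_ne_top [OpensMeasurableSpace (State Z)]
    (c : M.Candidate) (hu : M.InadaUtility) (hmom : M.MomentAssumption) {n : ℕ}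
    (hθ : M.theta n < 1) (hY : M.IncomeAssumption) {a : ℝ} (ha : 0 < a) (z : Z) :
    ∑' t, M.presentValue c.toFun a z t
      (fun ω => ENNReal.ofReal (M.consumption c.toFun a ω t)) ≠ ⊤ := by
  refine ne_top_of_le_ne_top (c.tsum_presentValue_assetPath_ne_top hu hmom hθ hY ha z)
    (ENNReal.tsum_le_tsum fun t => ?_)
  rw [presentValue_assetPath hu c.isFeasible c.isFeasible ha.le]
  exact le_self_add

lemma tsum_discountedMean_crossSum (hu : M.InadaUtility) {p x y : State Z → ℝ}
    (hx : IsFeasible x) (hy : IsFeasible y) (a : ℝ) (z : Z) :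
    ∑' t, M.discountedMean z t (fun ω => M.crossSum (M.consumption p a ω t)
        (M.consumption y a ω t) (M.consumption x a ω t)) =
      M.utilityPos y a z + M.utilityNeg x a z +
        ∑' t, M.presentValue p a z t fun ω => ENNReal.ofReal (M.consumption x a ω t) := by
  have h_pos (t : ℕ) : Measurable fun ω => M.posUtility (M.consumption y a ω t) :=
    hu.measurable_posUtility.comp (hy.measurable_consumption a t)
  have h_sum (t : ℕ) : Measurable fun ω =>
      M.posUtility (M.consumption y a ω t) + M.negUtility (M.consumption x a ω t) :=
    (h_pos t).add (hu.measurable_negUtility.comp (hx.measurable_consumption a t))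
  rw [utilityPos, utilityNeg, ← ENNReal.tsum_add, ← ENNReal.tsum_add]
  refine tsum_congr fun t => ?_
  rw [← discountedMean_add z t (h_pos t), presentValue, ← discountedMean_add z t (h_sum t)]
  rfl

lemma discountedMean_zero_crossSum (hu : M.InadaUtility) {p x y : State Z → ℝ}
    (hp : IsFeasible p) (hx : IsFeasible x) (hy : IsFeasible y) (a : ℝ) (z : Z) :
    M.discountedMean z 0 (fun ω => M.crossSum (M.consumption p a ω 0)
        (M.consumption y a ω 0) (M.consumption x a ω 0)) =
      M.crossSum (extend p a z) (extend y a z) (extend x a z) := by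
  have h_extend {c : State Z → ℝ} (hc : IsFeasible c) : Measurable fun z => extend c a z :=
    (measurable_extend hc.1).comp (measurable_const.prodMk measurable_id)
  exact discountedMean_zero
    (g := fun z => M.crossSum (extend p a z) (extend y a z) (extend x a z)) z
    (((hu.measurable_posUtility.comp (h_extend hy)).add
      (hu.measurable_negUtility.comp (h_extend hx))).add
      ((hu.measurable_marginalE.comp (h_extend hp)).mul (h_extend hx).ennreal_ofReal))

section Optimality

variable [OpensMeasurableSpace (State Z)] (hu : M.InadaUtility) (hmom : M.MomentAssumption)
  {n : ℕ} (hθ : M.theta n < 1) (hY : M.IncomeAssumption) {c : M.Candidate}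
  {d : State Z → ℝ} {a : ℝ} (z : Z)

namespace Candidate.IsEuler

variable (hE : c.IsEuler)
include hu hE

lemma presentValue_budget_le (hd : IsFeasible d) (ha : 0 ≤ a) (t : ℕ) :
    M.presentValue c.toFun a z t (fun ω => ENNReal.ofReal (M.consumption d a ω t)) +
      M.presentValue c.toFun a z (t + 1) (fun ω => ENNReal.ofReal (M.assetPath d a ω (t + 1))) ≤
    M.presentValue c.toFun a z t (fun ω => ENNReal.ofReal (M.assetPath d a ω t)) +
      M.presentValue c.toFun a z (t + 1) fun ω => M.incomeAt ω (t + 1) := by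
  rw [presentValue_assetPath_succ hu c.isFeasible hd ha,
    presentValue_assetPath hu c.isFeasible hd ha, add_assoc]
  gcongr
  refine discountedMean_mono z t fun ω => ?_
  rw [mul_comm (M.marginalE _)]
  exact mul_le_mul_right (hE.eulerMean_le _ _) _

lemma presentValue_budget_eq (ha : 0 ≤ a) (t : ℕ) :
    M.presentValue c.toFun a z t (fun ω => ENNReal.ofReal (M.consumption c.toFun a ω t)) +
      M.presentValue c.toFun a z (t + 1)
        (fun ω => ENNReal.ofReal (M.assetPath c.toFun a ω (t + 1))) =
    M.presentValue c.toFun a z t (fun ω => ENNReal.ofReal (M.assetPath c.toFun a ω t)) +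
      M.presentValue c.toFun a z (t + 1) fun ω => M.incomeAt ω (t + 1) := by
  have h_euler (ω : ℕ → Z × E × H) :=
    hE.savings_mul_eulerMean hu (M.assetPath c.toFun a ω t) (ω t).1
  rw [presentValue_assetPath_succ hu c.isFeasible c.isFeasible ha,
    presentValue_assetPath hu c.isFeasible c.isFeasible ha, add_assoc]
  congr 2
  exact congrArg (M.discountedMean z t) (funext fun ω => (h_euler ω).trans (mul_comm _ _))

include hmom hθ hY

lemma tsum_presentValue_consumption_le (hd : IsFeasible d) (ha : 0 < a) :
    ∑' t, M.presentValue c.toFun a z t (fun ω => ENNReal.ofReal (M.consumption d a ω t)) ≤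
      ∑' t, M.presentValue c.toFun a z t
        fun ω => ENNReal.ofReal (M.consumption c.toFun a ω t) :=
  (tsum_le_add_tsum_of_add_le_add (hE.presentValue_budget_le hu z hd ha.le)).trans_eq
    (tsum_eq_add_tsum_of_add_eq_add (hE.presentValue_budget_eq hu z ha.le)
      (c.tsum_presentValue_assetPath_ne_top hu hmom hθ hY ha z)).symm

end Candidate.IsEuler

include hu hmom hθ hY

/-- Lifetime utilities are compared as `V_d + δ ≤ V_c`, with the negative parts on the other
side. -/
lemma Candidate.IsEuler.utility_add_le (hE : c.IsEuler) (hd : IsFeasible d) (ha : 0 < a)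
    {δ : ℝ≥0∞} (hδ : M.crossSum (extend c.toFun a z) (extend d a z) (extend c.toFun a z) + δ ≤
      M.crossSum (extend c.toFun a z) (extend c.toFun a z) (extend d a z)) :
    M.utilityPos d a z + M.utilityNeg c.toFun a z + δ ≤
      M.utilityPos c.toFun a z + M.utilityNeg d a z := by
  have hc := c.isFeasible
  have h_tangent := tsum_add_le_tsum
    (f := fun t => M.discountedMean z t fun ω => M.crossSum (M.consumption c.toFun a ω t)
      (M.consumption d a ω t) (M.consumption c.toFun a ω t))
    (g := fun t => M.discountedMean z t fun ω => M.crossSum (M.consumption c.toFun a ω t)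
      (M.consumption c.toFun a ω t) (M.consumption d a ω t)) (δ := δ)
    (by rwa [discountedMean_zero_crossSum hu hc hc hd, discountedMean_zero_crossSum hu hc hd hc])
    fun t => discountedMean_mono z t fun ω =>
      hu.crossSum_le (hc.consumption_nonneg a ω t) (hd.consumption_nonneg a ω t)
  rw [tsum_discountedMean_crossSum hu hc hd, tsum_discountedMean_crossSum hu hd hc,
    add_right_comm] at h_tangent
  exact (ENNReal.add_le_add_iff_right
    (c.tsum_presentValue_consumption_ne_top hu hmom hθ hY ha z)).1 (h_tangent.trans
      (add_le_add_right (hE.tsum_presentValue_consumption_le hu hmom hθ hY z hd ha) _))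

theorem Candidate.IsEuler.isOptimal (hE : c.IsEuler) : M.IsOptimal c.toFun := by
  refine ⟨c.isFeasible, fun d hd s => ?_⟩
  have ha : (0 : ℝ) < s.1 := s.1.2
  have h_le := hE.utility_add_le hu hmom hθ hY s.2 hd ha (δ := 0) (by
    rw [add_zero]
    exact hu.crossSum_le (c.extend_pos ha s.2).le (extend_nonneg (fun s => (hd.2 s).1) _ _))
  rw [add_zero] at h_le
  rw [hd.lifetimeValue_eq hu, c.isFeasible.lifetimeValue_eq hu]
  exact coe_ennreal_sub_le_sub (hd.utilityPos_ne_top hu hmom hθ hY ha.le s.2)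
    (c.isFeasible.utilityPos_ne_top hu hmom hθ hY ha.le s.2) h_le

theorem Candidate.IsEuler.eq_of_isOptimal (hE : c.IsEuler) {d : M.Candidate}
    (hd : M.IsOptimal d.toFun) : d = c := by
  ext s
  by_contra h_ne
  have ha : (0 : ℝ) < s.1 := s.1.2
  obtain ⟨δ, hδ, h_gap⟩ := hu.exists_crossSum_add_le (c.pos s) (d.pos s) (Ne.symm h_ne)
  have h_le := hE.utility_add_le hu hmom hθ hY s.2 d.isFeasible ha (δ := δ) (by
    simpa only [extend_of_pos ha] using h_gap)
  have h_posUtility := d.isFeasible.utilityPos_ne_top hu hmom hθ hY ha.le s.2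
  have h_lt := coe_ennreal_sub_lt_sub (d.utilityNeg_ne_top hu hmom ha s.2)
    (c.isFeasible.utilityPos_ne_top hu hmom hθ hY ha.le s.2)
    ((ENNReal.lt_add_right (ENNReal.add_ne_top.2
      ⟨h_posUtility, c.utilityNeg_ne_top hu hmom ha s.2⟩) hδ).trans_le h_le)
  rw [← d.isFeasible.lifetimeValue_eq hu, ← c.isFeasible.lifetimeValue_eq hu] at h_lt
  exact h_lt.not_ge (hd.2 _ c.isFeasible s)

end Optimality

/-! ### Contraction of the Coleman operator -/

lemma rho_comm (c d : M.Candidate) : rho c d = rho d c := by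
  simp_rw [rho, abs_sub_comm]

namespace IsColeman

variable {T : M.Candidate → M.Candidate} (hT : M.IsColeman T)
include hT

lemma isEuler {c : M.Candidate} (hc : T c = c) : c.IsEuler := fun s => by
  simpa only [hc] using hT.marginalE_apply c s

variable (hu : M.InadaUtility)
include hu

theorem rho_iterate_le (n : ℕ) (c d : M.Candidate) :
    rho (T^[n] c) (T^[n] d) ≤ M.theta n * rho c d := by
  have h_le (c d : M.Candidate) (s : State Z) :
      M.marginalE ((T^[n] c).toFun s) ≤ M.marginalE ((T^[n] d).toFun s) + M.theta n * rho c d := by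
    have h_rho (s : State Z) : M.marginalE (c.toFun s) ≤ M.marginalE (d.toFun s) + rho c d :=
      ((Candidate.rho_le_iff hu).1 le_rfl s).1
    refine (hT.marginalE_iterate_le hu h_rho n s).trans ?_
    rw [theta_eq_pow_mul_supReturn, mul_comm _ (rho c d), ← mul_assoc]
    gcongr
    exact returnOp_iterate_one_le_supReturn n s.2
  exact (Candidate.rho_le_iff hu).2 fun s => ⟨h_le c d s, rho_comm d c ▸ h_le d c s⟩

theorem exists_unique_fixedPoint {n : ℕ} (hθ : M.theta n < 1) :
    ∃ c : M.Candidate, T c = c ∧ ∀ d : M.Candidate, T d = d → d = c := by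
  obtain ⟨D, hD, h_complete⟩ := Candidate.exists_completeSpace hu
  have hθ_coe : ((M.theta n).toNNReal : ℝ≥0∞) = M.theta n := ENNReal.coe_toNNReal hθ.ne_top
  have h_contracting : ContractingWith (M.theta n).toNNReal T^[n] := by
    refine ⟨ENNReal.coe_lt_coe.1 (hθ_coe.trans_lt hθ), fun c d => ?_⟩
    rw [hD, hD, hθ_coe]
    exact hT.rho_iterate_le hu n c d
  exact ⟨h_contracting.fixedPoint, h_contracting.isFixedPt_fixedPoint_iterate,
    fun d hd => h_contracting.fixedPoint_unique (Function.IsFixedPt.iterate hd n)⟩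

lemma rho_iterate_mul_le (n : ℕ) {cstar : M.Candidate} (h_fixed : T cstar = cstar)
    (c : M.Candidate) (k : ℕ) :
    rho (T^[n * k] c) cstar ≤ M.theta n ^ k * rho c cstar := by
  induction k with
  | zero => simp
  | succ k ih =>
    calc rho (T^[n * (k + 1)] c) cstar = rho (T^[n] (T^[n * k] c)) (T^[n] cstar) := by
          rw [Function.iterate_fixed h_fixed, ← Function.iterate_add_apply, Nat.mul_succ, add_comm]
      _ ≤ M.theta n * rho (T^[n * k] c) cstar := hT.rho_iterate_le hu n _ _
      _ ≤ M.theta n * (M.theta n ^ k * rho c cstar) := by gcongr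
      _ = M.theta n ^ (k + 1) * rho c cstar := by rw [pow_succ', mul_assoc]

end IsColeman

end IncomeFluctuation

end

theorem theoremt_general {Z E H : Type*} [TopologicalSpace Z]
    [TopologicalSpace.PseudoMetrizableSpace Z] [MeasurableSpace Z] [BorelSpace Z]
    [MeasurableSpace E] [MeasurableSpace H]
    (M : IncomeFluctuation Z E H) (hu : M.InadaUtility) (n : ℕ) (hθ : M.theta n < 1)
    (hY : M.IncomeAssumption) (hmom : M.MomentAssumption) (hcont : M.ContinuityAssumption) :
    (∃ D : MetricSpace M.Candidate,
      (∀ c d : M.Candidate, edist c d = IncomeFluctuation.rho c d) ∧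
      @CompleteSpace M.Candidate D.toUniformSpace) ∧
    ∃ T : M.Candidate → M.Candidate, M.IsColeman T ∧
      (∀ c d : M.Candidate,
        IncomeFluctuation.rho (T^[n] c) (T^[n] d) ≤ M.theta n * IncomeFluctuation.rho c d) ∧
      ∃ cstar : M.Candidate,
        (T cstar = cstar ∧ ∀ d : M.Candidate, T d = d → d = cstar) ∧
        (M.IsOptimal cstar.toFun ∧
          ∀ d : M.Candidate, M.IsOptimal d.toFun → d = cstar) ∧
        ∀ (c : M.Candidate) (k : ℕ),
          IncomeFluctuation.rho (T^[n * k] c) cstar ≤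
            M.theta n ^ k * IncomeFluctuation.rho c cstar := by
  obtain ⟨T, hT⟩ := IncomeFluctuation.exists_isColeman hu hmom hcont
  obtain ⟨cstar, h_fixed, h_unique⟩ := hT.exists_unique_fixedPoint hu hθ
  have hE := hT.isEuler h_fixed
  exact ⟨IncomeFluctuation.Candidate.exists_completeSpace hu, T, hT, hT.rho_iterate_le hu n,
    cstar, ⟨h_fixed, h_unique⟩,
    ⟨hE.isOptimal hu hmom hθ hY, fun d hd => hE.eq_of_isOptimal hu hmom hθ hY hd⟩,
    hT.rho_iterate_mul_le hu n h_fixed⟩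

theorem theoremt {m : ℕ} (Z : Set (EuclideanSpace ℝ (Fin m))) (hZ : MeasurableSet Z)
    {E H : Type*} [MeasurableSpace E] [MeasurableSpace H]
    (M : IncomeFluctuation Z E H)
    (hu : M.UtilityAssumption)
    (n : ℕ) (hn : 1 ≤ n) (hθ : M.theta n < 1)
    (hY : M.IncomeAssumption)
    (hmom : M.MomentAssumption)
    (hcont : M.ContinuityAssumption) :
    -- `(𝒞, ρ)` is a complete metric space
    (∃ D : MetricSpace M.Candidate,
      (∀ c d : M.Candidate, edist c d = IncomeFluctuation.rho c d) ∧
      @CompleteSpace M.Candidate D.toUniformSpace) ∧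
    -- the Coleman operator is a well-defined self-map of `𝒞`, and its `n`-th iterate contracts
    ∃ T : M.Candidate → M.Candidate, M.IsColeman T ∧
      (∀ c d : M.Candidate,
        IncomeFluctuation.rho (T^[n] c) (T^[n] d) ≤ M.theta n * IncomeFluctuation.rho c d) ∧
      ∃ cstar : M.Candidate,
        (T cstar = cstar ∧ ∀ d : M.Candidate, T d = d → d = cstar) ∧
        (M.IsOptimal cstar.toFun ∧
          ∀ d : M.Candidate, M.IsOptimal d.toFun → d = cstar) ∧
        ∀ (c : M.Candidate) (k : ℕ),
          IncomeFluctuation.rho (T^[n * k] c) cstar ≤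
            M.theta n ^ k * IncomeFluctuation.rho c cstar :=
  theoremt_general M hu.inadaUtility n hθ hY hmom hcont
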